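/- Let $p \in [1,\infty)$ and $T>0$. Processes are indexed by $[0,T]$ and defined on a filtered probability space $(\Omega,\mathcal F,(\mathcal F_t)_{t\in[0,T]},\mathbb P)$ satisfying the usual conditions; write $\mathbb E_s[\,\cdot\,]=\mathbb E[\,\cdot\,|\mathcal F_s]$. A partition $\mathcal P$ of $[s,t]$ is a finite sequence $s=t_0<t_1<\dots<t_n=t$, and $[u,v]\in\mathcal P$ means that $u,v$ are consecutive points of $\mathcal P$. For a process $Y$, let $$\|Y\|_{p,q,r,[0,T]} := \Big(\sup_{\mathcal P\subset[0,T]}\sum_{[u,v]\in\mathcal P}\big\|\mathbb E_u[|Y_v-Y_u|^q]\big\|_{L^r}^{p/q}\Big)^{1/p},$$ and let $V^pL^{q,r}$ be the space of processes $Y$ which are almost surely càdlàg, with $Y_0\in L^q$ and $\|Y\|_{p,q,r,[0,T]}<\infty$. For a càdlàg adapted process $V$, with the convention $V_{0-}:=V_0$, let $$\rho_{s,t}(V):=\sup_{s\le\sigma\le\tau\le t}\big\|\mathbb E[\,|V_\tau-V_{\sigma-}|\,|\mathcal F_\sigma]\big\|_{L^\infty}$$ (supremum over all stopping times $\sigma,\tau$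 with $s\le\sigma\le\tau\le t$), let $$\|V\|_{\mathrm{BMO}^{p\text{-var}},[0,T]}:=\Big(\sup_{\mathcal P\subset[0,T]}\sum_{[s,t]\in\mathcal P}\rho_{s,t}(V)^p\Big)^{1/p},$$ and let $\mathrm{BMO}^{p\text{-var}}$ be the class of càdlàg adapted processes for which this is finite. **Proposition.** If $V\in\mathrm{BMO}^{p\text{-var}}$ is a one-dimensional process with $V_0\in L^\infty$, then $\exp(V)\in V^pL^{q,r}$ for any $q,r\in[1,\infty)$. Moreover, if $q,\tilde q,r\in[1,\infty)$ are such that $\tilde q r<q$, and if $\widetilde V\in\mathrm{BMO}^{p\text{-var}}$ is another one-dimensional process (on the same filtered probability space) with $\widetilde V_0\in L^\infty$, then $$\big\|\exp(V)-\exp(\widetilde V)\big\|_{p,\tilde q,r,[0,T]}\le C\big(\|V_0-\widetilde V_0\|_{L^q}+\|V-\widetilde V\|_{p,q,r,[0,T]}\big),$$ where the constant $C>0$ depends only on $p,q,\tilde q,r$ and on upper bounds for $\|V_0\|_{L^\infty}$, $\|\widetilde V_0\|_{L^\infty}$, $\|V\|_{\mathrm{BMO}^{p\text{-var}},[0,T]}$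 and $\|\widetilde V\|_{\mathrm{BMO}^{p\text{-var}},[0,T]}$. -/

import Mathlib

open MeasureTheory Set Filter Topology
open scoped ENNReal NNReal

universe u

noncomputable section

namespace RoughBMO

section Paths

variable {ι E : Type*}

/-- Right-continuous paths with left limits. -/
def IsCadlag [LinearOrder ι] [TopologicalSpace ι] [TopologicalSpace E] (f : ι → E) : Prop :=
  ∀ t, ContinuousWithinAt f (Ici t) t ∧ ∃ l, Tendsto f (𝓝[<] t) (𝓝 l)

/-- The increments `δY_{s,t} = Y_t - Y_s` of a process, as a two-parameter process. -/
def increment {Ω : Type*} [Sub E] (Y : ι → Ω → E) (s t : ι) (ω : Ω) : E :=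
  Y t ω - Y s ω

/-- For a two-parameter function `w ≥ 0`, the quantity
`(sup_𝒫 ∑_{[u,v] ∈ 𝒫} w(u,v)^p)^{1/p}`, the supremum being taken over all partitions
`s = t_0 < t_1 < ⋯ < t_n = t` of `[s,t]`. -/
def pVariation [LinearOrder ι] (p : ℝ) (w : ι → ι → ℝ≥0∞) (s t : ι) : ℝ≥0∞ :=
  (⨆ (n : ℕ) (x : Fin (n + 1) → ι) (_ : StrictMono x) (_ : x 0 = s) (_ : x (Fin.last n) = t),
    ∑ i : Fin n, w (x i.castSucc) (x i.succ) ^ p) ^ (1 / p)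

end Paths

section Processes

variable {ι Ω E : Type*} [LinearOrder ι] {mΩ : MeasurableSpace Ω}

/-- The usual conditions: the filtration is right-continuous and every (subset of a)
`P`-null set belongs to every `𝓕 t`; in particular, `P` is complete. -/
structure UsualConditions (𝓕 : Filtration ι mΩ) (P : Measure Ω) : Prop where
  rightCont : 𝓕.IsRightContinuous
  complete : ∀ (t : ι) (A : Set Ω), P A = 0 → MeasurableSet[𝓕 t] A

/-- `‖Y‖_{q,r,𝒢} = ‖E[|Y|^q | 𝒢]‖_{L^r}^{1/q}`, with values in `[0,∞]`. -/
def condNorm [ENorm E] (P : Measure Ω) (q : ℝ) (r : ℝ≥0∞) (𝒢 : MeasurableSpace Ω)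
    (Y : Ω → E) : ℝ≥0∞ :=
  eLpNorm (condLExp 𝒢 P fun ω => ‖Y ω‖ₑ ^ q) r P ^ (1 / q)

/-- `‖F‖_{p,q,r,[s,t]}` for a two-parameter process `F`. -/
def pqrNorm [ENorm E] (𝓕 : Filtration ι mΩ) (P : Measure Ω) (p q : ℝ) (r : ℝ≥0∞)
    (F : ι → ι → Ω → E) (s t : ι) : ℝ≥0∞ :=
  pVariation p (fun u v => condNorm P q r (𝓕 u) (F u v)) s t

/-- The modulus of mean variation `ρ_{s,t}(V) = sup ‖E_σ[|V_τ - V_{σ-}|]‖_{L^∞}`, over all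
stopping times `s ≤ σ ≤ τ ≤ t`. At the smallest time `0` of the index set, `Function.leftLim`
gives `V_{0-} = V_0`. -/
def meanVariation [NormedAddCommGroup E] (𝓕 : Filtration ι mΩ) (P : Measure Ω)
    (V : ι → Ω → E) (s t : ι) : ℝ≥0∞ :=
  ⨆ (σ : Ω → ι) (τ : Ω → ι)
    (hσ : IsStoppingTime 𝓕 fun ω => (σ ω : WithTop ι))
    (_ : IsStoppingTime 𝓕 fun ω => (τ ω : WithTop ι))
    (_ : ∀ ω, s ≤ σ ω ∧ σ ω ≤ τ ω ∧ τ ω ≤ t),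
    eLpNorm (condLExp hσ.measurableSpace P
      fun ω => ‖V (τ ω) ω - Function.leftLim (fun u => V u ω) (σ ω)‖ₑ) ∞ P

/-- `‖V‖_{BMO^{p-var},[s,t]}`. -/
def bmoVarNorm [NormedAddCommGroup E] (𝓕 : Filtration ι mΩ) (P : Measure Ω) (p : ℝ)
    (V : ι → Ω → E) (s t : ι) : ℝ≥0∞ :=
  pVariation p (meanVariation 𝓕 P V) s t

/-- The class `BMO^{p-var}` over `[s,t]`, where `s` and `t` are the end points of the time
interval. -/
structure MemBMOVar [TopologicalSpace ι] [NormedAddCommGroup E] (𝓕 : Filtration ι mΩ)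
    (P : Measure Ω) (p : ℝ) (V : ι → Ω → E) (s t : ι) : Prop where
  adapted : StronglyAdapted 𝓕 V
  cadlag : ∀ᵐ ω ∂P, IsCadlag fun u => V u ω
  norm_lt_top : bmoVarNorm 𝓕 P p V s t < ∞

/-- The space `V^p L^{q,r}` over `[s,t]`, where `s` and `t` are the end points of the time
interval. -/
structure MemVpLqr [TopologicalSpace ι] [NormedAddCommGroup E] (𝓕 : Filtration ι mΩ)
    (P : Measure Ω) (p q : ℝ) (r : ℝ≥0∞) (Y : ι → Ω → E) (s t : ι) : Prop where
  measurable : ∀ u, StronglyMeasurable (Y u)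
  cadlag : ∀ᵐ ω ∂P, IsCadlag fun u => Y u ω
  initial : MemLp (Y s) (ENNReal.ofReal q) P
  norm_lt_top : pqrNorm 𝓕 P p q r (increment Y) s t < ∞

end Processes

/-- The initial time `0` of `[0,T]`. -/
def startTime {T : ℝ} (hT : 0 < T) : Icc (0 : ℝ) T := ⟨0, left_mem_Icc.2 hT.le⟩

/-- The final time `T` of `[0,T]`. -/
def endTime {T : ℝ} (hT : 0 < T) : Icc (0 : ℝ) T := ⟨T, right_mem_Icc.2 hT.le⟩

end RoughBMO

end

/-! The engine is a John–Nirenberg inequality: given `𝓕 s`, the increment `V_t - V_s` has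
geometrically decaying tails on the scale of the mean variation `ρ` on `[s,t]`. Starting from `σ =
s`, one stops repeatedly when `V` has moved by more than `a` from its last left limit `V_{σ-}`; by
Markov's inequality each further stop before `t` costs a factor `ρ / a`. Hence conditional moments
of order `m` are at most a constant times `ρ ^ m`, and conditional exponential moments of order
`lam` are bounded once `ρ ≤ 1 / (6 * lam)`.

The `BMO^{p-var}` condition removes this smallness restriction. The `p`-variation of the mean
variation is finite, so time splits into boundedly many stretches of small mean variation, separated
by single times at which the jump is at most `K`. Chaining across them gives conditional exponential
moments of every order (`MemBMOVar.setLIntegral_exp_le`).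

The rest is algebra and Hölder. With `δ` denoting increments, `δ(exp V - exp V')` is at most
`exp(|V_u| + |V'_u|)` times the sum of `|δ(V - V')| exp(|δV| + |δV'|)` and `|V_u - V'_u| |δV'|
exp|δV'|`. Conditional Hölder turns the first term into the conditional `q`-norm of `δ(V - V')`. The
second gains a factor `ρ(V')`, whose `p`-variation is finite. Minkowski's inequality sums these
bounds over partitions. Taking `V' = V` with the two differences replaced by `0` and `1` gives
finiteness for `exp V` itself.

Conditional bounds are mostly carried in integrated form, over all sets `A` of the conditioning
σ-algebra. -/

namespace RoughBMO

/-! ### Stopping times and right-continuous filtrations -/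

section StoppingTimes

variable {ι Ω : Type*} [LinearOrder ι] {mΩ : MeasurableSpace Ω} {𝓕 : Filtration ι mΩ}

/-- These events, settled strictly before `σ`, are the building blocks of the left limit `V_{σ-}`.
-/
lemma measurableSet_inter_lt_stoppingTime {σ : Ω → ι}
    (hσ : IsStoppingTime 𝓕 fun ω => (σ ω : WithTop ι)) {q : ι} {A : Set Ω}
    (hA : MeasurableSet[𝓕 q] A) : MeasurableSet[hσ.measurableSpace] (A ∩ {ω | q < σ ω}) := by
  have hlt : {ω | q < σ ω} = {ω | (σ ω : WithTop ι) ≤ q}ᶜ := by ext; simp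
  refine ⟨le_iSup (fun i => 𝓕 i) q _ (hA.inter (hlt ▸ (hσ q).compl)), fun i => ?_⟩
  rcases le_or_gt q i with h | h
  · exact ((𝓕.mono h _ hA).inter (𝓕.mono h _ (hlt ▸ (hσ q).compl))).inter (hσ i)
  · convert @MeasurableSet.empty _ (𝓕 i)
    ext ω
    simp only [mem_inter_iff, mem_ofPred_eq, WithTop.coe_le_coe, mem_empty_iff_false, iff_false]
    grind

variable [TopologicalSpace ι] [OrderTopology ι] [DenselyOrdered ι] [SecondCountableTopology ι]

lemma isStoppingTime_of_lt (hr : 𝓕.IsRightContinuous) {τ : Ω → ι}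
    (h : ∀ i, MeasurableSet[𝓕 i] {ω | τ ω < i}) :
    IsStoppingTime 𝓕 fun ω => (τ ω : WithTop ι) := by
  intro i
  simp only [WithTop.coe_le_coe]
  -- At a maximal time there is nothing to the right to approximate from, but `τ ≤ i` holds
  -- everywhere.
  by_cases hi : IsMax i
  · convert @MeasurableSet.univ _ (𝓕 i)
    ext ω
    simpa using hi.isTop (τ ω)
  · rw [← Filtration.IsRightContinuous.eq (𝓕 := 𝓕), Filtration.rightCont_eq_of_not_isMax _ hi]
    simp only [MeasurableSpace.measurableSet_iInf]
    intro j hj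
    obtain ⟨s, -, hs, hlim⟩ := exists_seq_strictAnti_tendsto' hj
    have : {ω | τ ω ≤ i} = ⋂ m, {ω | τ ω < s m} := by
      ext ω
      simp only [mem_ofPred_eq, mem_iInter]
      exact ⟨fun h m => h.trans_lt (hs m).1, fun h => ge_of_tendsto' hlim fun m => (h m).le⟩
    rw [this]
    exact MeasurableSet.iInter fun m => 𝓕.mono (hs m).2.le _ (h _)

end StoppingTimes

/-! ### Left limits of càdlàg paths -/

section Cadlag

variable {ι : Type*} [LinearOrder ι] [TopologicalSpace ι] [OrderTopology ι] [DenselyOrdered ι]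

lemma nhdsLT_neBot_of_not_isBot {u : ι} (hu : ¬ IsBot u) : (𝓝[<] u).NeBot := by
  simp only [IsBot, not_forall, not_le] at hu
  exact nhdsLT_neBot_of_exists_lt hu

lemma IsCadlag.tendsto_leftLim {f : ι → ℝ} (hf : IsCadlag f) {u : ι} (hu : ¬ IsBot u) :
    Tendsto f (𝓝[<] u) (𝓝 (Function.leftLim f u)) := by
  have := nhdsLT_neBot_of_not_isBot hu
  obtain ⟨l, hl⟩ := (hf u).2
  rwa [leftLim_eq_of_tendsto hl]

/-- The rational gap between `c` and `r` keeps the inequality strict in the limit, and all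
quantifiers range over countable sets once `D` is countable, which is what measurability needs. -/
lemma IsCadlag.lt_leftLim_iff {f : ι → ℝ} (hf : IsCadlag f) {u : ι} (hu : ¬ IsBot u)
    {D : Set ι} (hD : Dense D) (c : ℝ) :
    c < Function.leftLim f u ↔
      ∃ r : ℚ, c < r ∧ ∃ q ∈ D, q < u ∧ ∀ q' ∈ D, q ≤ q' → q' < u → (r : ℝ) ≤ f q' := by
  have hl := hf.tendsto_leftLim hu
  have hex : ∃ l, l < u := by simpa [IsBot] using hu
  constructor
  · intro h
    obtain ⟨r, hcr, hr⟩ := exists_rat_btwn h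
    obtain ⟨l, hlu, hl'⟩ := (mem_nhdsLT_iff_exists_Ioo_subset' hex.choose_spec).1
      (hl.eventually_const_lt hr)
    obtain ⟨q, hq, hqD⟩ := hD.exists_between hlu
    exact ⟨r, hcr, q, hq, hqD.2, fun q' _ h1 h2 => (hl' ⟨hqD.1.trans_le h1, h2⟩).le⟩
  · rintro ⟨r, hcr, q, hq, hqu, h⟩
    refine hcr.trans_le (not_lt.1 fun hlt => ?_)
    obtain ⟨l, hlu, hl'⟩ := (mem_nhdsLT_iff_exists_Ioo_subset' hex.choose_spec).1
      (hl.eventually_lt_const hlt)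
    obtain ⟨q', hq', hqD'⟩ := hD.exists_between (max_lt hlu hqu)
    have h1 := hl' ⟨(le_max_left _ _).trans_lt hqD'.1, hqD'.2⟩
    have h2 := h q' hq' ((le_max_right _ _).trans hqD'.1.le) hqD'.2
    exact absurd h1 (not_lt.2 h2)

end Cadlag

/-! ### Measurability of left limits, and hitting times -/

section Hitting

variable {ι Ω : Type*} [LinearOrder ι] [TopologicalSpace ι] [OrderTopology ι] [DenselyOrdered ι]
  [SecondCountableTopology ι] {mΩ : MeasurableSpace Ω} {𝓕 : Filtration ι mΩ} {V : ι → Ω → ℝ}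

/-- The left limit of an adapted càdlàg process at a stopping time `σ` is `𝓕_σ`-measurable. -/
lemma measurable_leftLim_stoppingTime (hV : ∀ u, Measurable[𝓕 u] (V u))
    (hc : ∀ ω, IsCadlag fun u => V u ω) {σ : Ω → ι}
    (hσ : IsStoppingTime 𝓕 fun ω => (σ ω : WithTop ι)) :
    Measurable[hσ.measurableSpace] fun ω => Function.leftLim (fun u => V u ω) (σ ω) := by
  obtain ⟨D, hDc, hD⟩ := TopologicalSpace.exists_countable_dense ι
  refine @measurable_of_Ioi _ _ _ _ _ hσ.measurableSpace _ _ _ _ fun c => ?_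
  have hset : (fun ω => Function.leftLim (fun u => V u ω) (σ ω)) ⁻¹' Ioi c =
      (⋃ r : {r : ℚ // c < r}, ⋃ q ∈ D, {ω | q < σ ω} ∩
        ⋂ q' ∈ D, ⋂ _ : q ≤ q', ({ω | V q' ω < (r : ℚ)} ∩ {ω | q' < σ ω})ᶜ) ∪
      {ω | IsBot (σ ω) ∧ c < V (σ ω) ω} := by
    ext ω
    simp only [mem_preimage, mem_Ioi, mem_union, mem_iUnion, mem_inter_iff, mem_ofPred_eq,
      mem_iInter, mem_compl_iff, not_and, not_lt, exists_prop, Subtype.exists]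
    by_cases hb : IsBot (σ ω)
    · have : ∀ q, ¬ q < σ ω := fun q => not_lt.2 (hb q)
      simp [leftLim_eq_of_isBot hb, hb, this]
    · rw [(hc ω).lt_leftLim_iff hb hD]
      simp only [hb, false_and, or_false]
      refine exists_congr fun r => and_congr_right fun _ => exists_congr fun q =>
        and_congr_right fun _ => and_congr_right fun _ => forall_congr' fun q' =>
        forall_congr' fun _ => forall_congr' fun _ => ?_
      constructor
      · intro h h1
        by_contra h2
        exact absurd (h (not_le.1 h2)) (not_le.2 h1)
      · intro h h1
        by_contra h2
        exact absurd h1 (not_lt.2 (h (not_le.1 h2)))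
  rw [hset]
  refine MeasurableSet.union ?_ ?_
  · refine MeasurableSet.iUnion fun r => MeasurableSet.biUnion hDc fun q _ => ?_
    refine MeasurableSet.inter ?_ (MeasurableSet.biInter hDc fun q' _ =>
      MeasurableSet.iInter fun _ => MeasurableSet.compl ?_)
    · simpa using measurableSet_inter_lt_stoppingTime hσ (@MeasurableSet.univ _ (𝓕 q))
    · exact measurableSet_inter_lt_stoppingTime hσ (hV q' measurableSet_Iio)
  · by_cases hex : ∃ b : ι, IsBot b
    · obtain ⟨b, hb⟩ := hex
      have : {ω | IsBot (σ ω) ∧ c < V (σ ω) ω} =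
          {ω | c < V b ω} ∩ {ω | (σ ω : WithTop ι) ≤ b} := by
        ext ω
        simp only [mem_ofPred_eq, mem_inter_iff, WithTop.coe_le_coe]
        constructor
        · rintro ⟨h1, h2⟩
          have : σ ω = b := le_antisymm (h1 b) (hb _)
          exact ⟨this ▸ h2, this.le⟩
        · rintro ⟨h1, h2⟩
          have : σ ω = b := le_antisymm h2 (hb _)
          exact ⟨this ▸ hb, this ▸ h1⟩
      rw [this]
      have hm : MeasurableSet[𝓕 b] ({ω | c < V b ω} ∩ {ω | (σ ω : WithTop ι) ≤ b}) :=
        (hV b measurableSet_Ioi).inter (hσ b)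
      refine ⟨le_iSup (fun i => 𝓕 i) b _ hm, fun i => ?_⟩
      exact (𝓕.mono (hb i) _ hm).inter (hσ i)
    · convert @MeasurableSet.empty _ hσ.measurableSpace
      ext ω
      simp only [mem_ofPred_eq, mem_empty_iff_false, iff_false]
      exact fun h => hex ⟨_, h.1⟩

variable [CompactSpace ι]

/-- Displacement is measured from the left limit at `σ`, and is controlled from above only at the
left limit at `τ`. The jump at `τ` therefore never enters when the construction is iterated,
although it may be what carries the path past `a`. -/
lemma exists_hittingTime (hr : 𝓕.IsRightContinuous) (hV : ∀ u, Measurable[𝓕 u] (V u))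
    (hc : ∀ ω, IsCadlag fun u => V u ω) {σ : Ω → ι}
    (hσ : IsStoppingTime 𝓕 fun ω => (σ ω : WithTop ι)) {t : ι} (hσt : ∀ ω, σ ω ≤ t) {a : ℝ}
    (ha : 0 ≤ a) :
    ∃ τ : Ω → ι, IsStoppingTime 𝓕 (fun ω => (τ ω : WithTop ι)) ∧
      (∀ ω, σ ω ≤ τ ω ∧ τ ω ≤ t) ∧
      (∀ ω, |Function.leftLim (fun u => V u ω) (τ ω) -
        Function.leftLim (fun u => V u ω) (σ ω)| ≤ a) ∧
      ∀ ω, τ ω < t → a ≤ |V (τ ω) ω - Function.leftLim (fun u => V u ω) (σ ω)| := by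
  set L : Ω → ℝ := fun ω => Function.leftLim (fun u => V u ω) (σ ω) with hL
  have hLm : Measurable[hσ.measurableSpace] L := measurable_leftLim_stoppingTime hV hc hσ
  -- The alternative `u = t` keeps the set nonempty, so a path that never exceeds `a` is stopped at
  -- `t`.
  let S : Ω → Set ι := fun ω => {u | σ ω ≤ u ∧ u ≤ t ∧ (a < |V u ω - L ω| ∨ u = t)}
  have htS : ∀ ω, t ∈ S ω := fun ω => ⟨hσt ω, le_rfl, Or.inr rfl⟩
  have hglb : ∀ ω, ∃ g, IsGLB (S ω) g := fun ω => by
    obtain ⟨g, -, hg⟩ := (isClosed_closure (s := S ω)).isCompact.exists_isGLB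
      ⟨t, subset_closure (htS ω)⟩
    exact ⟨g, fun u hu => hg.1 (subset_closure hu), fun b hb =>
      hg.2 (fun u hu => closure_minimal (t := Ici b) hb isClosed_Ici hu)⟩
  choose τ hτ using hglb
  have hστ : ∀ ω, σ ω ≤ τ ω := fun ω => (hτ ω).2 fun u hu => hu.1
  have hτt : ∀ ω, τ ω ≤ t := fun ω => (hτ ω).1 (htS ω)
  have hbefore : ∀ ω u, σ ω ≤ u → u < τ ω → |V u ω - L ω| ≤ a := by
    intro ω u h1 h2
    by_contra h
    exact absurd ((hτ ω).1 ⟨h1, h2.le.trans (hτt ω), Or.inl (not_le.1 h)⟩) (not_le.2 h2)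
  refine ⟨τ, isStoppingTime_of_lt hr fun i => ?_, fun ω => ⟨hστ ω, hτt ω⟩, fun ω => ?_,
    fun ω hlt => ?_⟩
  · rcases lt_or_ge t i with hi | hi
    · convert @MeasurableSet.univ _ (𝓕 i)
      ext ω
      simpa using (hτt ω).trans_lt hi
    obtain ⟨D, hDc, hD⟩ := TopologicalSpace.exists_countable_dense ι
    -- Right-continuity moves a strict crossing to a nearby point of the countable set `D`. Cutting
    -- `L` off outside `σ ≤ q` makes it measurable at time `q`.
    have hset : {ω | τ ω < i} = ⋃ q ∈ D, ⋃ _ : q < i,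
        {ω | a < |V q ω - {ω | (σ ω : WithTop ι) ≤ q}.indicator L ω|} ∩
          {ω | (σ ω : WithTop ι) ≤ q} := by
      ext ω
      simp only [mem_ofPred_eq, mem_iUnion, mem_inter_iff, WithTop.coe_le_coe, exists_prop]
      constructor
      · intro h
        obtain ⟨v, hv, hvi⟩ := (isGLB_lt_iff (hτ ω)).1 h
        have hva : a < |V v ω - L ω| := hv.2.2.resolve_right (hvi.trans_le hi).ne
        have hcont : Tendsto (fun u => |V u ω - L ω|) (𝓝[>] v) (𝓝 |V v ω - L ω|) :=
          ((((hc ω) v).1.tendsto.mono_left (nhdsWithin_mono _ Ioi_subset_Ici_self)).sub_const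
            _).abs
        obtain ⟨w, hw, hw'⟩ := (mem_nhdsGT_iff_exists_Ioo_subset' hvi).1
          (hcont.eventually_const_lt hva)
        obtain ⟨q, hq, hqD⟩ := hD.exists_between (lt_min hw hvi)
        have hσq : σ ω ≤ q := hv.1.trans hqD.1.le
        refine ⟨q, hq, hqD.2.trans_le (min_le_right _ _), ?_, hσq⟩
        rw [indicator_of_mem (by simpa using hσq)]
        exact hw' ⟨hqD.1, hqD.2.trans_le (min_le_left _ _)⟩
      · rintro ⟨q, -, hqi, h, hσq⟩
        rw [indicator_of_mem (by simpa using hσq)] at h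
        exact ((hτ ω).1 ⟨hσq, hqi.le.trans hi, Or.inl h⟩).trans_lt hqi
    rw [hset]
    refine MeasurableSet.biUnion hDc fun q _ => MeasurableSet.iUnion fun hqi => ?_
    refine 𝓕.mono hqi.le _ (MeasurableSet.inter ?_ (hσ q))
    have hind : Measurable[𝓕 q] ({ω | (σ ω : WithTop ι) ≤ q}.indicator L) := by
      refine @measurable_of_Ioi _ _ _ _ _ (𝓕 q) _ _ _ _ fun c => ?_
      have hq : MeasurableSet[𝓕 q] {ω | (σ ω : WithTop ι) ≤ q} := hσ q
      have h1 : MeasurableSet[𝓕 q] (L ⁻¹' Ioi c ∩ {ω | (σ ω : WithTop ι) ≤ q}) :=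
        (hLm measurableSet_Ioi).2 q
      by_cases h0 : c < 0
      · convert h1.union hq.compl using 1
        ext ω
        by_cases hm : ω ∈ {ω | (σ ω : WithTop ι) ≤ q}
        · simp only [mem_preimage, indicator_of_mem hm, mem_union, mem_inter_iff, hm,
            mem_compl_iff, and_true, not_true, or_false]
        · simp only [mem_preimage, indicator_of_notMem hm, mem_union, mem_inter_iff, hm,
            mem_compl_iff, and_false, not_false_iff, or_true, mem_Ioi, h0]
      · convert h1 using 1
        ext ω
        by_cases hm : ω ∈ {ω | (σ ω : WithTop ι) ≤ q}
        · simp only [mem_preimage, indicator_of_mem hm, mem_inter_iff, hm, and_true]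
        · simp only [mem_preimage, indicator_of_notMem hm, mem_inter_iff, hm, and_false,
            mem_Ioi, h0]
    have hm : Measurable[𝓕 q] fun ω => |V q ω - {ω | (σ ω : WithTop ι) ≤ q}.indicator L ω| :=
      continuous_abs.measurable.comp ((hV q).sub hind)
    exact hm measurableSet_Ioi
  · rcases (hστ ω).eq_or_lt with h | h
    · rw [← h]
      simpa [hL] using ha
    · have hnb : ¬ IsBot (τ ω) := fun hb => absurd (hb (σ ω)) (not_le.2 h)
      have := nhdsLT_neBot_of_not_isBot hnb
      refine le_of_tendsto (((hc ω).tendsto_leftLim hnb).sub_const (L ω)).abs ?_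
      filter_upwards [Ioo_mem_nhdsLT h] with u hu
      exact hbefore ω u hu.1.le hu.2
  · have hfr := (hτ ω).frequently_mem ⟨t, htS ω⟩
    have hev : ∀ᶠ u in 𝓝[≥] (τ ω), u < t :=
      mem_nhdsWithin_of_mem_nhds (Iio_mem_nhds hlt)
    have hcont : Tendsto (fun u => |V u ω - L ω|) (𝓝[≥] (τ ω)) (𝓝 |V (τ ω) ω - L ω|) :=
      ((((hc ω) (τ ω)).1.tendsto).sub_const _).abs
    by_contra hcon
    obtain ⟨u, hu, hut, hu3⟩ :=
      (hfr.and_eventually (hev.and (hcont.eventually_lt_const (not_le.1 hcon)))).exists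
    rcases hu.2.2 with h | h
    · exact absurd h (not_lt.2 hu3.le)
    · exact hut.ne h

end Hitting

/-! ### The John–Nirenberg inequality -/

section JohnNirenberg

variable {ι Ω : Type*} [LinearOrder ι] {mΩ : MeasurableSpace Ω}

/-- The bound `E[|V_τ - V_{σ-}| | 𝓕_σ] ≤ ρ` for all stopping times `s ≤ σ ≤ τ ≤ t`, in integrated
form. -/
def MeanVariationLE (𝓕 : Filtration ι mΩ) (P : Measure Ω) (V : ι → Ω → ℝ) (s t : ι)
    (ρ : ℝ≥0∞) : Prop :=
  ∀ (σ τ : Ω → ι) (hσ : IsStoppingTime 𝓕 fun ω => (σ ω : WithTop ι)),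
    IsStoppingTime 𝓕 (fun ω => (τ ω : WithTop ι)) →
    (∀ ω, s ≤ σ ω ∧ σ ω ≤ τ ω ∧ τ ω ≤ t) →
    ∀ A, MeasurableSet[hσ.measurableSpace] A →
      ∫⁻ ω in A, ‖V (τ ω) ω - Function.leftLim (fun u => V u ω) (σ ω)‖ₑ ∂P ≤ ρ * P A

variable {𝓕 : Filtration ι mΩ} {P : Measure Ω} {V V' : ι → Ω → ℝ} {s t : ι} {ρ : ℝ≥0∞}

lemma meanVariationLE_of_meanVariation_le [IsProbabilityMeasure P]
    (h : meanVariation 𝓕 P V s t ≤ ρ) (hVV' : ∀ᵐ ω ∂P, ∀ u, V' u ω = V u ω) :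
    MeanVariationLE 𝓕 P V' s t ρ := by
  intro σ τ hσ hτ hστ A hA
  have h1 : eLpNorm (condLExp hσ.measurableSpace P
      fun ω => ‖V (τ ω) ω - Function.leftLim (fun u => V u ω) (σ ω)‖ₑ) ∞ P ≤ ρ := by
    refine le_trans ?_ h
    unfold meanVariation
    exact le_iSup_of_le σ (le_iSup_of_le τ (le_iSup_of_le hσ (le_iSup_of_le hτ
      (le_iSup_of_le hστ le_rfl))))
  calc ∫⁻ ω in A, ‖V' (τ ω) ω - Function.leftLim (fun u => V' u ω) (σ ω)‖ₑ ∂P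
      = ∫⁻ ω in A, ‖V (τ ω) ω - Function.leftLim (fun u => V u ω) (σ ω)‖ₑ ∂P := by
        refine lintegral_congr_ae (ae_restrict_of_ae ?_)
        filter_upwards [hVV'] with ω hω
        simp only [hω]
    _ = ∫⁻ ω in A, condLExp hσ.measurableSpace P
          (fun ω => ‖V (τ ω) ω - Function.leftLim (fun u => V u ω) (σ ω)‖ₑ) ω ∂P :=
        (setLIntegral_condLExp hσ.measurableSpace_le P _ hA).symm
    _ ≤ ∫⁻ _ in A, ρ ∂P := by
        refine lintegral_mono_ae (ae_restrict_of_ae ?_)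
        have := enorm_ae_le_eLpNormEssSup (condLExp hσ.measurableSpace P
          fun ω => ‖V (τ ω) ω - Function.leftLim (fun u => V u ω) (σ ω)‖ₑ) P
        filter_upwards [this] with ω hω
        rw [eLpNorm_exponent_top] at h1
        simpa using hω.trans h1
    _ = ρ * P A := by simp

variable [TopologicalSpace ι] [OrderTopology ι] [DenselyOrdered ι] [SecondCountableTopology ι]

lemma measurable_leftLim (hV : ∀ u, Measurable[𝓕 u] (V u))
    (hc : ∀ ω, IsCadlag fun u => V u ω) (u : ι) :
    Measurable[𝓕 u] fun ω => Function.leftLim (fun v => V v ω) u := by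
  have := measurable_leftLim_stoppingTime hV hc (σ := fun _ => u) (isStoppingTime_const 𝓕 u)
  rwa [IsStoppingTime.measurableSpace_const] at this

/-- Take `σ = τ = u`: the jump is then already `𝓕 u`-measurable, so a conditional bound is an almost
sure one. -/
lemma MeanVariationLE.jump_le [IsProbabilityMeasure P] (h : MeanVariationLE 𝓕 P V s t ρ)
    (hV : ∀ u, Measurable[𝓕 u] (V u)) (hc : ∀ ω, IsCadlag fun u => V u ω) {u : ι}
    (hsu : s ≤ u) (hut : u ≤ t) :
    ∀ᵐ ω ∂P, ‖V u ω - Function.leftLim (fun v => V v ω) u‖ₑ ≤ ρ := by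
  have hm : Measurable[𝓕 u] fun ω => ‖V u ω - Function.leftLim (fun v => V v ω) u‖ₑ :=
    measurable_enorm.comp ((hV u).sub (measurable_leftLim hV hc u))
  refine ae_le_of_ae_le_trim (hm := 𝓕.le u) ?_
  refine ae_le_of_forall_setLIntegral_le_of_sigmaFinite (μ := P.trim (𝓕.le u)) hm ?_
  intro A hA _
  rw [setLIntegral_trim (𝓕.le u) hm hA, setLIntegral_trim (𝓕.le u) measurable_const hA]
  have := h (fun _ => u) (fun _ => u) (isStoppingTime_const 𝓕 u) (isStoppingTime_const 𝓕 u)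
    (fun _ => ⟨hsu, le_rfl, hut⟩) A (by rwa [IsStoppingTime.measurableSpace_const])
  simpa using this

variable [CompactSpace ι]

/-- Markov's inequality between consecutive hitting times: where the next one comes before `t`, the
displacement is at least `a`, while its integral over the event that the previous one came before
`t` is at most `ρ` times the probability of that event. -/
lemma MeanVariationLE.exists_iterated_hittingTime [IsProbabilityMeasure P]
    (h : MeanVariationLE 𝓕 P V s t ρ)
    (hr : 𝓕.IsRightContinuous) (hV : ∀ u, Measurable[𝓕 u] (V u))
    (hc : ∀ ω, IsCadlag fun u => V u ω) (hst : s ≤ t) {a : ℝ} (ha : 0 ≤ a) (n : ℕ) :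
    ∃ τ : Ω → ι, IsStoppingTime 𝓕 (fun ω => (τ ω : WithTop ι)) ∧ (∀ ω, s ≤ τ ω ∧ τ ω ≤ t) ∧
      (∀ ω, |Function.leftLim (fun u => V u ω) (τ ω) - Function.leftLim (fun u => V u ω) s|
        ≤ n * a) ∧
      ∀ A, MeasurableSet[𝓕 s] A →
        P (A ∩ {ω | τ ω < t}) * ENNReal.ofReal a ^ n ≤ ρ ^ n * P A := by
  induction n with
  | zero =>
    refine ⟨fun _ => s, isStoppingTime_const 𝓕 s, fun _ => ⟨le_rfl, hst⟩, by simp, fun A _ => ?_⟩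
    simpa using measure_mono inter_subset_left
  | succ n ih =>
    obtain ⟨τ, hτ, hst', hdist, hprob⟩ := ih
    obtain ⟨τ', hτ', hττ', hdist', hhit⟩ :=
      exists_hittingTime hr hV hc hτ (fun ω => (hst' ω).2) ha
    refine ⟨τ', hτ', fun ω => ⟨(hst' ω).1.trans (hττ' ω).1, (hττ' ω).2⟩, fun ω => ?_,
      fun A hA => ?_⟩
    · calc _ ≤ _ := abs_sub_le _ (Function.leftLim (fun u => V u ω) (τ ω)) _
        _ ≤ a + n * a := add_le_add (hdist' ω) (hdist ω)
        _ = _ := by push_cast; ring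
    · set B := A ∩ {ω | τ ω < t} with hB
      have hBm : MeasurableSet[hτ.measurableSpace] B := by
        refine MeasurableSet.inter ?_ ?_
        · exact hτ.le_measurableSpace_of_const_le
            (fun ω => WithTop.coe_le_coe.2 (hst' ω).1) _ hA
        · have := hτ.measurableSet_lt' t
          simpa using this
      have hlt' : MeasurableSet {ω | τ' ω < t} := by
        have := hτ'.measurableSpace_le _ (hτ'.measurableSet_lt' t)
        simpa using this
      have hsub : A ∩ {ω | τ' ω < t} ⊆ B := fun ω hω => ⟨hω.1, (hττ' ω).1.trans_lt hω.2⟩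
      have key : P (A ∩ {ω | τ' ω < t}) * ENNReal.ofReal a ≤ ρ * P B := by
        refine le_trans ?_ (h τ τ' hτ hτ' (fun ω => ⟨(hst' ω).1, hττ' ω⟩) B hBm)
        calc P (A ∩ {ω | τ' ω < t}) * ENNReal.ofReal a
            = ∫⁻ _ in A ∩ {ω | τ' ω < t}, ENNReal.ofReal a ∂P := by simp [mul_comm]
          _ ≤ ∫⁻ ω in A ∩ {ω | τ' ω < t},
                ‖V (τ' ω) ω - Function.leftLim (fun u => V u ω) (τ ω)‖ₑ ∂P := by
              refine setLIntegral_mono' ((𝓕.le s _ hA).inter hlt') fun ω hω => ?_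
              rw [Real.enorm_eq_ofReal_abs]
              exact ENNReal.ofReal_le_ofReal (hhit ω hω.2)
          _ ≤ _ := lintegral_mono_set hsub
      calc P (A ∩ {ω | τ' ω < t}) * ENNReal.ofReal a ^ (n + 1)
          = P (A ∩ {ω | τ' ω < t}) * ENNReal.ofReal a * ENNReal.ofReal a ^ n := by ring
        _ ≤ ρ * P B * ENNReal.ofReal a ^ n := by gcongr
        _ = ρ * (P B * ENNReal.ofReal a ^ n) := by ring
        _ ≤ ρ * (ρ ^ n * P A) := by gcongr ρ * ?_; exact hprob A hA
        _ = _ := by ring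

/-- The John–Nirenberg inequality: exponential decay of the tails of an increment. -/
lemma MeanVariationLE.measure_lt_abs_sub_le [IsProbabilityMeasure P]
    (h : MeanVariationLE 𝓕 P V s t ρ)
    (hr : 𝓕.IsRightContinuous) (hV : ∀ u, Measurable[𝓕 u] (V u))
    (hc : ∀ ω, IsCadlag fun u => V u ω) (hst : s ≤ t) {a : ℝ} (ha : 0 ≤ a)
    (hρa : ρ ≤ ENNReal.ofReal a) (n : ℕ) {A : Set Ω} (hA : MeasurableSet[𝓕 s] A) :
    P (A ∩ {ω | (n + 2) * a < |V t ω - V s ω|}) * ENNReal.ofReal a ^ n ≤ ρ ^ n * P A := by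
  obtain ⟨τ, hτ, hst', hdist, hprob⟩ := h.exists_iterated_hittingTime hr hV hc hst ha n
  refine le_trans ?_ (hprob A hA)
  gcongr ?_ * _
  refine measure_mono_ae ?_
  -- If the `n`-th hitting time equals `t`, the left limits at `s` and `t` differ by at most `n *
  -- a`; the jumps at `s` and `t` add at most `a` each, whence `n + 2`.
  filter_upwards [h.jump_le hV hc le_rfl hst, h.jump_le hV hc hst le_rfl] with ω h1 h2 hω
  refine ⟨hω.1, lt_of_le_of_ne (hst' ω).2 fun heq => ?_⟩
  have h3 := hdist ω
  rw [heq] at h3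
  have toR : ∀ x : ℝ, ‖x‖ₑ ≤ ρ → |x| ≤ a := fun x hx => by
    rw [Real.enorm_eq_ofReal_abs] at hx
    exact (ENNReal.ofReal_le_ofReal_iff ha).1 (hx.trans hρa)
  have h1' := toR _ h1
  have h2' := toR _ h2
  have h4 : (n + 2) * a < |V t ω - V s ω| := hω.2
  rw [abs_le] at h1' h2' h3
  rcases lt_abs.1 h4 with h5 | h5 <;> nlinarith

end JohnNirenberg

/-! ### From tails to moments -/

section Tails

variable {Ω : Type*} {mΩ : MeasurableSpace Ω} {P : Measure Ω}

/-- Layer decomposition: `X` is either at most `2 * a` or lies in `((n + 2) * a, (n + 3) * a]` for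
some `n`, where `φ` is bounded by its value at the right end. -/
lemma setLIntegral_le_of_tail {X : Ω → ℝ} (hX : Measurable X) {A : Set Ω}
    {a : ℝ} (ha : 0 < a) {θ : ℝ≥0∞} {φ : ℝ → ℝ≥0∞} (hφ : Monotone φ)
    (h : ∀ n : ℕ, P (A ∩ {ω | (n + 2) * a < X ω}) ≤ θ ^ n * P A) :
    ∫⁻ ω in A, φ (X ω) ∂P ≤ (φ (2 * a) + ∑' n : ℕ, φ ((n + 3) * a) * θ ^ n) * P A := by
  have hS : ∀ n : ℕ, MeasurableSet {ω | (n + 2) * a < X ω} := fun n =>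
    measurableSet_lt measurable_const hX
  have hpt : ∀ ω, φ (X ω) ≤ φ (2 * a) +
      ∑' n : ℕ, {ω | (n + 2) * a < X ω}.indicator (fun _ => φ ((n + 3) * a)) ω := by
    intro ω
    by_cases hx : X ω ≤ 2 * a
    · exact (hφ hx).trans le_self_add
    · push Not at hx
      obtain ⟨n, hn1, hn2⟩ : ∃ n : ℕ, (n + 2) * a < X ω ∧ X ω ≤ (n + 3) * a := by
        have hex : ∃ n : ℕ, X ω ≤ (n + 3) * a := by
          obtain ⟨n, hn⟩ := exists_nat_ge (X ω / a)
          refine ⟨n, ?_⟩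
          rw [div_le_iff₀ ha] at hn
          nlinarith
        classical
        refine ⟨Nat.find hex, ?_, Nat.find_spec hex⟩
        rcases hk : Nat.find hex with _ | k
        · simpa using hx
        · have := Nat.find_min hex (m := k) (by omega)
          push Not at this
          push_cast
          have e : (k : ℝ) + 1 + 2 = k + 3 := by ring
          rwa [e]
      refine (hφ hn2).trans (le_trans ?_ le_add_self)
      refine le_trans ?_ (ENNReal.le_tsum n)
      rw [indicator_of_mem (by exact hn1)]
  calc ∫⁻ ω in A, φ (X ω) ∂P
      ≤ ∫⁻ ω in A, (φ (2 * a) +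
          ∑' n : ℕ, {ω | (n + 2) * a < X ω}.indicator (fun _ => φ ((n + 3) * a)) ω) ∂P :=
        lintegral_mono hpt
    _ = φ (2 * a) * P A + ∑' n : ℕ, φ ((n + 3) * a) * P (A ∩ {ω | (n + 2) * a < X ω}) := by
        rw [lintegral_add_left measurable_const, lintegral_tsum
          fun n => (measurable_const.indicator (hS n)).aemeasurable]
        congr 1
        · simp
        · refine tsum_congr fun n => ?_
          rw [lintegral_indicator_const (hS n), Measure.restrict_apply (hS n), inter_comm]
    _ ≤ φ (2 * a) * P A + ∑' n : ℕ, φ ((n + 3) * a) * (θ ^ n * P A) := by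
        gcongr with n
        exact h n
    _ = _ := by
        rw [add_mul, ← ENNReal.tsum_mul_right]
        simp only [mul_assoc]

end Tails

/-! ### Integrals against a sub-σ-algebra -/

section SubSigmaAlgebra

variable {Ω : Type*} {𝒢 mΩ : MeasurableSpace Ω} {P : Measure Ω}

/-- The hypothesis compares the measures with densities `Y` and `Y'` after restriction to `𝒢`, and a
`𝒢`-measurable `Z` is integrated only against these restrictions. It plays the role of pulling out
known factors. -/
lemma setLIntegral_mul_le_of_forall_setLIntegral_le (h𝒢 : 𝒢 ≤ mΩ) {Y Y' Z : Ω → ℝ≥0∞}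
    (hY : Measurable Y) (hY' : Measurable Y') (hZ : Measurable[𝒢] Z)
    (h : ∀ A, MeasurableSet[𝒢] A → ∫⁻ ω in A, Y ω ∂P ≤ ∫⁻ ω in A, Y' ω ∂P)
    {A : Set Ω} (hA : MeasurableSet[𝒢] A) :
    ∫⁻ ω in A, Z ω * Y ω ∂P ≤ ∫⁻ ω in A, Z ω * Y' ω ∂P := by
  have key : ∀ X : Ω → ℝ≥0∞, Measurable X →
      ∫⁻ ω in A, Z ω * X ω ∂P = ∫⁻ ω in A, Z ω ∂((P.withDensity X).trim h𝒢) := fun X hX => by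
    rw [setLIntegral_trim h𝒢 hZ hA,
      setLIntegral_withDensity_eq_setLIntegral_mul _ hX (hZ.mono h𝒢 le_rfl) (h𝒢 _ hA)]
    simp only [Pi.mul_apply, mul_comm]
  rw [key Y hY, key Y' hY']
  refine lintegral_mono' (Measure.restrict_mono le_rfl (Measure.le_iff.2 fun B hB => ?_)) le_rfl
  rw [trim_measurableSet_eq h𝒢 hB, trim_measurableSet_eq h𝒢 hB, withDensity_apply _ (h𝒢 _ hB),
    withDensity_apply _ (h𝒢 _ hB)]
  exact h B hB

lemma setLIntegral_le_of_tendsto {f : ℕ → Ω → ℝ≥0∞} {g : Ω → ℝ≥0∞} {A : Set Ω} {c : ℝ≥0∞}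
    (hf : ∀ n, Measurable (f n)) (hlim : ∀ ω, Tendsto (fun n => f n ω) atTop (𝓝 (g ω)))
    (h : ∀ n, ∫⁻ ω in A, f n ω ∂P ≤ c) : ∫⁻ ω in A, g ω ∂P ≤ c := by
  calc ∫⁻ ω in A, g ω ∂P = ∫⁻ ω in A, liminf (fun n => f n ω) atTop ∂P :=
        lintegral_congr fun ω => (hlim ω).liminf_eq.symm
    _ ≤ liminf (fun n => ∫⁻ ω in A, f n ω ∂P) atTop := lintegral_liminf_le hf
    _ ≤ c := by
        refine liminf_le_of_le (by isBoundedDefault) fun b hb => ?_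
        obtain ⟨n, hn⟩ := hb.exists
        exact hn.trans (h n)

end SubSigmaAlgebra

/-! ### Constants of the John–Nirenberg bounds -/

section Constants

/-- The bound for exponential moments in the John–Nirenberg inequality. -/
noncomputable def expConst : ℝ≥0∞ :=
  ENNReal.ofReal (Real.exp 2) +
    ∑' n : ℕ, ENNReal.ofReal (Real.exp (n + 3)) * ENNReal.ofReal (1 / 6) ^ n

/-- The bound for the moments of order `m` in the John–Nirenberg inequality. -/
noncomputable def momentConst (m : ℝ) : ℝ≥0∞ :=
  ENNReal.ofReal (4 ^ m) +
    ∑' n : ℕ, ENNReal.ofReal ((2 * (n + 3)) ^ m) * ENNReal.ofReal (1 / 2) ^ n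

/-- The series is geometric with ratio `e / 6 < 1`; this is what the threshold `1 / (6 * lam)` is
chosen for. -/
lemma expConst_ne_top : expConst ≠ ∞ := by
  refine ENNReal.add_ne_top.2 ⟨ENNReal.ofReal_ne_top, ?_⟩
  have h : ∀ n : ℕ, ENNReal.ofReal (Real.exp (n + 3)) * ENNReal.ofReal (1 / 6) ^ n =
      ENNReal.ofReal (Real.exp 3 * (Real.exp 1 / 6) ^ n) := fun n => by
    rw [← ENNReal.ofReal_pow (by norm_num), ← ENNReal.ofReal_mul (Real.exp_pos _).le]
    congr 1
    rw [Real.exp_add, div_pow, div_pow, ← Real.exp_nat_mul, mul_one, one_pow]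
    ring
  simp only [h]
  refine Summable.tsum_ofReal_ne_top (Summable.mul_left _
    (summable_geometric_of_lt_one (by positivity) ?_))
  have := Real.exp_one_lt_d9
  rw [div_lt_one (by norm_num)]
  linarith

lemma one_le_expConst : 1 ≤ expConst := by
  refine le_trans ?_ le_self_add
  rw [ENNReal.one_le_ofReal]
  exact Real.one_le_exp (by norm_num)

lemma momentConst_ne_top (m : ℝ) : momentConst m ≠ ∞ := by
  refine ENNReal.add_ne_top.2 ⟨ENNReal.ofReal_ne_top, ?_⟩
  have h : ∀ n : ℕ, ENNReal.ofReal ((2 * (n + 3)) ^ m) * ENNReal.ofReal (1 / 2) ^ n =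
      ENNReal.ofReal ((2 * ((n : ℝ) + 3)) ^ m * (1 / 2) ^ n) := fun n => by
    rw [← ENNReal.ofReal_pow (by norm_num), ← ENNReal.ofReal_mul (by positivity)]
  simp only [h]
  refine Summable.tsum_ofReal_ne_top ?_
  have hs : Summable fun n : ℕ => (n : ℝ) ^ ⌈m⌉₊ * (1 / 2) ^ n :=
    summable_pow_mul_geometric_of_norm_lt_one _ (by norm_num)
  -- The factor `8` undoes the shift by three in `(1 / 2) ^ (n + 3)`.
  have hs' := ((summable_nat_add_iff 3).2 hs).mul_left (2 ^ ⌈m⌉₊ * 8)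
  refine Summable.of_nonneg_of_le (fun n => by positivity) (fun n => ?_) hs'
  calc (2 * ((n : ℝ) + 3)) ^ m * (1 / 2) ^ n
      ≤ (2 * ((n : ℝ) + 3)) ^ ((⌈m⌉₊ : ℕ) : ℝ) * (1 / 2) ^ n := by
        gcongr
        · have : (0 : ℝ) ≤ n := n.cast_nonneg
          linarith
        · exact Nat.le_ceil m
    _ = _ := by
        rw [Real.rpow_natCast, mul_pow, pow_add (1 / 2 : ℝ) n 3]
        push_cast
        ring

end Constants

/-! ### Conditional polynomial and exponential moments of increments -/

section Moments

variable {ι Ω : Type*} [LinearOrder ι] {mΩ : MeasurableSpace Ω} {𝓕 : Filtration ι mΩ}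
  {P : Measure Ω} {V : ι → Ω → ℝ} {s t : ι} {ρ : ℝ≥0∞}

lemma measurable_abs_sub (hV : ∀ u, Measurable[𝓕 u] (V u)) (s t : ι) :
    Measurable fun ω => |V t ω - V s ω| :=
  continuous_abs.measurable.comp
    (((hV t).mono (𝓕.le t) le_rfl).sub ((hV s).mono (𝓕.le s) le_rfl))

variable [TopologicalSpace ι] [OrderTopology ι] [DenselyOrdered ι] [SecondCountableTopology ι]
  [CompactSpace ι]

lemma MeanVariationLE.setLIntegral_exp_le [IsProbabilityMeasure P] {lam : ℝ} (hlam : 0 < lam)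
    (h : MeanVariationLE 𝓕 P V s t (ENNReal.ofReal (1 / (6 * lam))))
    (hr : 𝓕.IsRightContinuous) (hV : ∀ u, Measurable[𝓕 u] (V u))
    (hc : ∀ ω, IsCadlag fun u => V u ω) (hst : s ≤ t) {A : Set Ω} (hA : MeasurableSet[𝓕 s] A) :
    ∫⁻ ω in A, ENNReal.ofReal (Real.exp (lam * |V t ω - V s ω|)) ∂P ≤ expConst * P A := by
  -- At the scale `a = 1 / lam` the tail ratio is `ρ / a = 1 / 6`.
  have ha : 0 < 1 / lam := by positivity
  have := setLIntegral_le_of_tail (P := P) (A := A) (measurable_abs_sub hV s t) ha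
    (θ := ENNReal.ofReal (1 / 6)) (φ := fun x => ENNReal.ofReal (Real.exp (lam * x)))
    (fun x y hxy => by dsimp only; gcongr) (fun n => ?_)
  · convert this using 2
    have e : ∀ x : ℝ, lam * (x * (1 / lam)) = x := fun x => by field_simp
    simp only [e, expConst]
  · have h1 := h.measure_lt_abs_sub_le hr hV hc hst ha.le
      (ENNReal.ofReal_le_ofReal
      (one_div_le_one_div_of_le hlam (by linarith))) n hA
    have e : ENNReal.ofReal (1 / (6 * lam)) = ENNReal.ofReal (1 / 6) * ENNReal.ofReal (1 / lam) := by
      rw [← ENNReal.ofReal_mul (by norm_num)]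
      congr 1
      field_simp
    have h0 : ENNReal.ofReal (1 / lam) ^ n ≠ 0 := pow_ne_zero _ (by simpa using hlam)
    rw [e, mul_pow, mul_right_comm] at h1
    exact (ENNReal.mul_le_mul_iff_left h0 (ENNReal.pow_ne_top ENNReal.ofReal_ne_top)).1 h1

lemma MeanVariationLE.setLIntegral_rpow_le [IsProbabilityMeasure P] {m : ℝ} (hm : 0 < m)
    (h : MeanVariationLE 𝓕 P V s t ρ) (hρ : ρ ≠ ∞)
    (hr : 𝓕.IsRightContinuous) (hV : ∀ u, Measurable[𝓕 u] (V u))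
    (hc : ∀ ω, IsCadlag fun u => V u ω) (hst : s ≤ t) {A : Set Ω} (hA : MeasurableSet[𝓕 s] A) :
    ∫⁻ ω in A, ‖V t ω - V s ω‖ₑ ^ m ∂P ≤ momentConst m * ρ ^ m * P A := by
  -- The scale `2 * r`, with tail ratio `1 / 2`, must be positive; `ρ = 0` is reached by letting `r`
  -- decrease to `ρ`.
  have main : ∀ r : ℝ≥0, 0 < r → ρ ≤ r →
      ∫⁻ ω in A, ‖V t ω - V s ω‖ₑ ^ m ∂P ≤ momentConst m * (r : ℝ≥0∞) ^ m * P A := by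
    intro r hr0 hρr
    have ha : 0 < 2 * (r : ℝ) := by positivity
    have := setLIntegral_le_of_tail (P := P) (A := A) (measurable_abs_sub hV s t) ha
      (θ := ENNReal.ofReal (1 / 2)) (φ := fun x => ENNReal.ofReal x ^ m)
      (fun x y hxy => by dsimp only; gcongr) (fun n => ?_)
    · simp only [Real.enorm_eq_ofReal_abs]
      refine this.trans_eq ?_
      congr 1
      have e : ∀ x : ℝ, 0 < x → ENNReal.ofReal (x * (2 * (r : ℝ))) ^ m =
          ENNReal.ofReal ((2 * x) ^ m) * (r : ℝ≥0∞) ^ m := fun x hx => by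
        rw [← ENNReal.ofReal_coe_nnreal, ENNReal.ofReal_rpow_of_pos (by positivity),
          ENNReal.ofReal_rpow_of_pos (by positivity), ← ENNReal.ofReal_mul (by positivity),
          ← Real.mul_rpow (by positivity) (by positivity)]
        congr 2
        ring
      rw [e 2 (by norm_num), momentConst, add_mul, ← ENNReal.tsum_mul_right]
      congr 1
      · norm_num
      · refine tsum_congr fun n => ?_
        rw [e _ (by positivity)]
        ring
    · have h1 := h.measure_lt_abs_sub_le hr hV hc hst ha.le (hρr.trans (by
        rw [← ENNReal.ofReal_coe_nnreal]
        exact ENNReal.ofReal_le_ofReal (by linarith [r.2]))) n hA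
      have e : (r : ℝ≥0∞) = ENNReal.ofReal (1 / 2) * ENNReal.ofReal (2 * r) := by
        rw [← ENNReal.ofReal_mul (by norm_num), ← ENNReal.ofReal_coe_nnreal]
        congr 1
        ring
      have h0 : ENNReal.ofReal (2 * r) ^ n ≠ 0 := pow_ne_zero _ (by simpa using hr0.ne')
      have h2 : P (A ∩ {ω | (n + 2) * (2 * (r : ℝ)) < |V t ω - V s ω|}) *
          ENNReal.ofReal (2 * r) ^ n ≤ (r : ℝ≥0∞) ^ n * P A := h1.trans (by gcongr)
      rw [e, mul_pow, mul_right_comm] at h2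
      exact (ENNReal.mul_le_mul_iff_left h0 (ENNReal.pow_ne_top ENNReal.ofReal_ne_top)).1 h2
  lift ρ to ℝ≥0 using hρ
  have hlim : Tendsto (fun n : ℕ => momentConst m * ((ρ + 1 / ((n : ℝ≥0) + 1) : ℝ≥0) : ℝ≥0∞) ^ m *
      P A) atTop (𝓝 (momentConst m * (ρ : ℝ≥0∞) ^ m * P A)) := by
    have h1 : Tendsto (fun n : ℕ => ρ + 1 / ((n : ℝ≥0) + 1)) atTop (𝓝 (ρ + 0)) :=
      tendsto_const_nhds.add tendsto_one_div_add_atTop_nhds_zero_nat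
    rw [add_zero] at h1
    have h2 := ((ENNReal.continuous_rpow_const (y := m)).tendsto _).comp
      (ENNReal.tendsto_coe.2 h1)
    refine ENNReal.Tendsto.mul_const (ENNReal.Tendsto.const_mul h2 ?_) ?_
    · exact Or.inr (momentConst_ne_top m)
    · exact Or.inr (measure_ne_top _ _)
  refine ge_of_tendsto' hlim fun n => main _ (by positivity) ?_
  exact_mod_cast le_self_add

/-- Think of `W u` as the variation remaining after `u`. It may itself jump, so closed intervals
over which it drops by at most `δ` need not cover. Induction on the number of `δ`-steps instead
isolates one exceptional time `b`: it uses the stretch up to `b-`, the jump at `b`, and the stretch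
after `b`, conditioning at `b` to multiply the bounds. -/
lemma setLIntegral_exp_le_of_control [IsProbabilityMeasure P] {lam K : ℝ} (hlam : 0 < lam)
    (hK : 0 ≤ K)
    (hr : 𝓕.IsRightContinuous) (hV : ∀ u, Measurable[𝓕 u] (V u))
    (hc : ∀ ω, IsCadlag fun u => V u ω)
    (hjump : ∀ u, ∀ᵐ ω ∂P, |V u ω - Function.leftLim (fun v => V v ω) u| ≤ K)
    {W : ι → ℝ} (hW : Antitone W) {δ : ℝ} (hδ : 0 ≤ δ)
    (hloc : ∀ u v, u < v → W u ≤ W v + δ →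
      MeanVariationLE 𝓕 P V u v (ENNReal.ofReal (1 / (6 * lam)))) (N : ℕ) :
    ∀ u v, u ≤ v → W u ≤ W v + (N + 1) * δ → ∀ A, MeasurableSet[𝓕 u] A →
      ∫⁻ ω in A, ENNReal.ofReal (Real.exp (lam * |V v ω - V u ω|)) ∂P ≤
        expConst * (ENNReal.ofReal (Real.exp (lam * K)) * expConst) ^ N * P A := by
  have hmeas : ∀ u v, Measurable fun ω => ENNReal.ofReal (Real.exp (lam * |V v ω - V u ω|)) :=
    fun u v => ENNReal.measurable_ofReal.comp
      (Real.measurable_exp.comp ((measurable_abs_sub hV u v).const_mul lam))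
  have hcont : Continuous fun x : ℝ => ENNReal.ofReal (Real.exp (lam * |x|)) :=
    ENNReal.continuous_ofReal.comp (by fun_prop)
  have hJ : 1 ≤ ENNReal.ofReal (Real.exp (lam * K)) := by
    rw [ENNReal.one_le_ofReal]
    exact Real.one_le_exp (by positivity)
  induction N with
  | zero =>
    intro u v huv hWuv A hA
    rcases huv.eq_or_lt with rfl | hlt
    · simpa using le_mul_of_one_le_left' one_le_expConst
    simpa using (hloc u v hlt (by simpa using hWuv)).setLIntegral_exp_le hlam hr hV hc huv hA
  | succ N ih =>
    intro u v huv hWuv A hA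
    set J := ENNReal.ofReal (Real.exp (lam * K)) with hJdef
    set c := expConst * (J * expConst) ^ N with hcdef
    have hc1 : 1 ≤ c := one_le_mul one_le_expConst
      (one_le_pow₀ (one_le_mul hJ one_le_expConst))
    let S : Set ι := {w | u ≤ w ∧ w ≤ v ∧ W u ≤ W w + (N + 1) * δ}
    have huS : u ∈ S := ⟨le_rfl, huv, by linarith [show 0 ≤ ((N : ℝ) + 1) * δ by positivity]⟩
    obtain ⟨b, hb⟩ : ∃ b, IsLUB S b := by
      obtain ⟨g, -, hg⟩ := (isClosed_closure (s := S)).isCompact.exists_isLUB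
        ⟨u, subset_closure huS⟩
      exact ⟨g, fun w hw => hg.1 (subset_closure hw), fun d hd =>
        hg.2 (fun w hw => closure_minimal (t := Iic d) hd isClosed_Iic hw)⟩
    have hub : u ≤ b := hb.1 huS
    have hbv : b ≤ v := hb.2 fun w hw => hw.2.1
    -- The induction hypothesis holds up to every time before `b`. Fatou carries it to the left
    -- limit, and the jump at `b` costs the factor `J`.
    have left : ∫⁻ ω in A, ENNReal.ofReal (Real.exp (lam * |V b ω - V u ω|)) ∂P ≤ c * J * P A := by
      rcases hub.eq_or_lt with heq | hlt
      · subst heq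
        simpa using le_mul_of_one_le_left' (one_le_mul hc1 hJ)
      have hnb : ¬ IsBot b := fun h => absurd (h u) (not_le.2 hlt)
      obtain ⟨w, -, hw, hwlim⟩ := exists_seq_strictMono_tendsto' hlt
      have hwlim' : Tendsto w atTop (𝓝[<] b) :=
        tendsto_nhdsWithin_iff.2 ⟨hwlim, .of_forall fun n => (hw n).2⟩
      have h1 : ∫⁻ ω in A, ENNReal.ofReal (Real.exp (lam *
          |Function.leftLim (fun x => V x ω) b - V u ω|)) ∂P ≤ c * P A := by
        refine setLIntegral_le_of_tendsto (fun n => hmeas u (w n)) (fun ω => ?_) fun n => ?_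
        · exact (hcont.tendsto _).comp
            ((((hc ω).tendsto_leftLim hnb).comp hwlim').sub_const _)
        · obtain ⟨x, hx, hwx⟩ := (lt_isLUB_iff hb).1 (hw n).2
          exact ih u (w n) (hw n).1.le (by linarith [hW hwx.le, hx.2.2]) A hA
      calc ∫⁻ ω in A, ENNReal.ofReal (Real.exp (lam * |V b ω - V u ω|)) ∂P
          ≤ ∫⁻ ω in A, J * ENNReal.ofReal (Real.exp (lam *
              |Function.leftLim (fun x => V x ω) b - V u ω|)) ∂P := by
            refine lintegral_mono_ae (ae_restrict_of_ae ?_)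
            filter_upwards [hjump b] with ω hω
            rw [hJdef, ← ENNReal.ofReal_mul (Real.exp_pos _).le, ← Real.exp_add, ← mul_add]
            gcongr
            exact (abs_sub_le _ (Function.leftLim (fun x => V x ω) b) _).trans (by gcongr)
        _ = J * ∫⁻ ω in A, ENNReal.ofReal (Real.exp (lam *
              |Function.leftLim (fun x => V x ω) b - V u ω|)) ∂P :=
            lintegral_const_mul' _ _ ENNReal.ofReal_ne_top
        _ ≤ J * (c * P A) := by gcongr
        _ = _ := by ring
    -- Any `w` in `(b, v)` lies outside `S`, so more than `(N + 1) * δ` has been used up by then and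
    -- at most `δ` remains to `v`. Right-continuity and Fatou let `w` decrease to `b`.
    have right : ∀ B, MeasurableSet[𝓕 b] B →
        ∫⁻ ω in B, ENNReal.ofReal (Real.exp (lam * |V v ω - V b ω|)) ∂P ≤
          ∫⁻ _ in B, expConst ∂P := by
      intro B hB
      simp only [lintegral_const, Measure.restrict_apply, MeasurableSet.univ, univ_inter]
      rcases hbv.eq_or_lt with heq | hlt
      · rw [heq]
        simpa using le_mul_of_one_le_left' one_le_expConst
      obtain ⟨w, -, hw, hwlim⟩ := exists_seq_strictAnti_tendsto' hlt
      have hwlim' : Tendsto w atTop (𝓝[≥] b) :=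
        tendsto_nhdsWithin_iff.2 ⟨hwlim, .of_forall fun n => (hw n).1.le⟩
      refine setLIntegral_le_of_tendsto (fun n => hmeas (w n) v) (fun ω => ?_) fun n => ?_
      · exact (hcont.tendsto _).comp (((hc ω b).1.tendsto.comp hwlim').const_sub _)
      · have hn : ¬ W u ≤ W (w n) + (N + 1) * δ := fun h =>
          absurd (hb.1 ⟨hub.trans (hw n).1.le, (hw n).2.le, h⟩) (not_le.2 (hw n).1)
        push_cast at hWuv
        exact (hloc (w n) v (hw n).2 (by linarith)).setLIntegral_exp_le hlam hr hV hc
          (hw n).2.le (𝓕.mono (hw n).1.le _ hB)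
    have hmb : Measurable[𝓕 b] fun ω => ENNReal.ofReal (Real.exp (lam * |V b ω - V u ω|)) :=
      hcont.measurable.comp ((hV b).sub ((hV u).mono (𝓕.mono hub) le_rfl))
    calc ∫⁻ ω in A, ENNReal.ofReal (Real.exp (lam * |V v ω - V u ω|)) ∂P
        ≤ ∫⁻ ω in A, ENNReal.ofReal (Real.exp (lam * |V b ω - V u ω|)) *
            ENNReal.ofReal (Real.exp (lam * |V v ω - V b ω|)) ∂P := by
          refine lintegral_mono fun ω => ?_
          rw [← ENNReal.ofReal_mul (Real.exp_pos _).le, ← Real.exp_add, ← mul_add]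
          gcongr
          linarith [abs_sub_le (V v ω) (V b ω) (V u ω)]
      _ ≤ ∫⁻ ω in A, ENNReal.ofReal (Real.exp (lam * |V b ω - V u ω|)) * expConst ∂P :=
          setLIntegral_mul_le_of_forall_setLIntegral_le (𝓕.le b) (hmeas b v) measurable_const
            hmb right (𝓕.mono hub _ hA)
      _ = (∫⁻ ω in A, ENNReal.ofReal (Real.exp (lam * |V b ω - V u ω|)) ∂P) * expConst :=
          lintegral_mul_const' _ _ expConst_ne_top
      _ ≤ c * J * P A * expConst := by gcongr
      _ = _ := by rw [hcdef]; ring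

end Moments

/-! ### Superadditivity and Minkowski's inequality for `p`-variation -/

section Partitions

variable {ι : Type*} [LinearOrder ι]

/-- The supremum of the partition sums of `w ^ p` over `[s,t]`. -/
noncomputable def partitionSup (p : ℝ) (w : ι → ι → ℝ≥0∞) (s t : ι) : ℝ≥0∞ :=
  ⨆ (n : ℕ) (x : Fin (n + 1) → ι) (_ : StrictMono x) (_ : x 0 = s) (_ : x (Fin.last n) = t),
    ∑ i : Fin n, w (x i.castSucc) (x i.succ) ^ p

variable {p : ℝ} {w : ι → ι → ℝ≥0∞} {s t u v : ι}

lemma sum_le_partitionSup {n : ℕ} {x : Fin (n + 1) → ι} (hx : StrictMono x) (h0 : x 0 = s)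
    (hn : x (Fin.last n) = t) :
    ∑ i : Fin n, w (x i.castSucc) (x i.succ) ^ p ≤ partitionSup p w s t :=
  le_iSup_of_le n (le_iSup_of_le x (le_iSup_of_le hx (le_iSup_of_le h0
    (le_iSup_of_le hn le_rfl))))

lemma rpow_add_sum_le_partitionSup (huv : u < v) {n : ℕ} {x : Fin (n + 1) → ι}
    (hx : StrictMono x) (h0 : x 0 = v) (hn : x (Fin.last n) = t) :
    w u v ^ p + ∑ i : Fin n, w (x i.castSucc) (x i.succ) ^ p ≤ partitionSup p w u t := by
  have hmono : StrictMono (Fin.cons u x : Fin (n + 2) → ι) := by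
    rw [Fin.strictMono_iff_lt_succ]
    intro i
    refine Fin.cases ?_ (fun j => ?_) i
    · simpa [h0] using huv
    · rw [← Fin.succ_castSucc, Fin.cons_succ, Fin.cons_succ]
      exact hx j.castSucc_lt_succ
  have := sum_le_partitionSup (p := p) (w := w) (s := u) (t := t) hmono (by simp)
    (by rw [← Fin.succ_last, Fin.cons_succ, hn])
  rw [Fin.sum_univ_succ] at this
  simpa [h0, ← Fin.succ_castSucc] using this

lemma exists_partition (hst : s ≤ t) : ∃ (n : ℕ) (x : Fin (n + 1) → ι), StrictMono x ∧ x 0 = s ∧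
    x (Fin.last n) = t := by
  rcases hst.eq_or_lt with rfl | h
  · exact ⟨0, fun _ => s, fun i j h => absurd h (by omega), rfl, rfl⟩
  · refine ⟨1, ![s, t], ?_, rfl, rfl⟩
    rw [Fin.strictMono_iff_lt_succ]
    intro i
    fin_cases i
    simpa using h

lemma rpow_le_partitionSup (huv : u < v) (hvt : v ≤ t) :
    w u v ^ p ≤ partitionSup p w u t := by
  obtain ⟨n, x, hx, h0, hn⟩ := exists_partition hvt
  exact le_self_add.trans (rpow_add_sum_le_partitionSup huv hx h0 hn)

/-- Prepending `[u,v]` to a partition of `[v,t]` gives one of `[u,t]`. Hence a small drop of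
`partitionSup p w · t` between `u` and `v` forces `w u v` to be small. -/
lemma rpow_add_partitionSup_le (huv : u < v) (hvt : v ≤ t) :
    w u v ^ p + partitionSup p w v t ≤ partitionSup p w u t := by
  by_cases htop : w u v ^ p = ∞
  · exact le_top.trans (htop.ge.trans (rpow_le_partitionSup huv hvt))
  refine add_le_of_le_tsub_left_of_le (rpow_le_partitionSup huv hvt) ?_
  refine iSup_le fun n => iSup_le fun x => iSup_le fun hx => iSup_le fun h0 => iSup_le fun hn => ?_
  exact ENNReal.le_sub_of_add_le_left htop (rpow_add_sum_le_partitionSup huv hx h0 hn)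

lemma partitionSup_antitone (huv : u ≤ v) (hvt : v ≤ t) :
    partitionSup p w v t ≤ partitionSup p w u t := by
  rcases huv.eq_or_lt with rfl | h
  · exact le_rfl
  · exact le_add_self.trans (rpow_add_partitionSup_le h hvt)

lemma partitionSup_eq_pVariation_rpow (hp : 0 < p) :
    partitionSup p w s t = pVariation p w s t ^ p := by
  rw [pVariation, ← ENNReal.rpow_mul, one_div_mul_cancel hp.ne', ENNReal.rpow_one]
  rfl

lemma le_pVariation (hp : 0 < p) (hsu : s ≤ u) (huv : u < v) (hvt : v ≤ t) :
    w u v ≤ pVariation p w s t := by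
  rw [← ENNReal.rpow_le_rpow_iff hp, ← partitionSup_eq_pVariation_rpow hp]
  exact (rpow_le_partitionSup huv hvt).trans (partitionSup_antitone hsu (huv.le.trans hvt))

/-- Minkowski's inequality in `ℓ^p` on each partition, before the suprema are taken. -/
lemma pVariation_le_of_le (hp : 1 ≤ p) {w₁ w₂ w₃ : ι → ι → ℝ≥0∞} {C M : ℝ≥0∞}
    (h : ∀ u v, s ≤ u → u < v → v ≤ t → w₁ u v ≤ C * (w₂ u v + M * w₃ u v)) :
    pVariation p w₁ s t ≤ C * (pVariation p w₂ s t + M * pVariation p w₃ s t) := by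
  have hp0 : 0 < p := one_pos.trans_le hp
  rw [← ENNReal.rpow_le_rpow_iff hp0, ← partitionSup_eq_pVariation_rpow hp0]
  refine iSup_le fun n => iSup_le fun x => iSup_le fun hx => iSup_le fun h0 => iSup_le fun hn => ?_
  rw [← ENNReal.rpow_inv_le_iff hp0]
  have hsum : ∀ w : ι → ι → ℝ≥0∞,
      (∑ i : Fin n, w (x i.castSucc) (x i.succ) ^ p) ^ (1 / p) ≤ pVariation p w s t := fun w =>
    ENNReal.rpow_le_rpow (sum_le_partitionSup hx h0 hn) (by positivity)
  have hmul : ∀ (c : ℝ≥0∞) (f : Fin n → ℝ≥0∞),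
      (∑ i, (c * f i) ^ p) ^ (1 / p) = c * (∑ i, f i ^ p) ^ (1 / p) := fun c f => by
    simp only [ENNReal.mul_rpow_of_nonneg _ _ hp0.le]
    rw [← Finset.mul_sum, ENNReal.mul_rpow_of_nonneg _ _ (by positivity), ← ENNReal.rpow_mul,
      mul_one_div_cancel hp0.ne', ENNReal.rpow_one]
  rw [← one_div]
  calc (∑ i : Fin n, w₁ (x i.castSucc) (x i.succ) ^ p) ^ (1 / p)
      ≤ (∑ i : Fin n, (C * (w₂ (x i.castSucc) (x i.succ) +
          M * w₃ (x i.castSucc) (x i.succ))) ^ p) ^ (1 / p) := by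
        gcongr with i
        refine h _ _ ?_ (hx i.castSucc_lt_succ) ?_
        · exact h0 ▸ hx.monotone (Fin.zero_le _)
        · exact hn ▸ hx.monotone (Fin.le_last _)
    _ = C * (∑ i : Fin n, (w₂ (x i.castSucc) (x i.succ) +
          M * w₃ (x i.castSucc) (x i.succ)) ^ p) ^ (1 / p) := hmul C _
    _ ≤ C * ((∑ i : Fin n, w₂ (x i.castSucc) (x i.succ) ^ p) ^ (1 / p) +
          (∑ i : Fin n, (M * w₃ (x i.castSucc) (x i.succ)) ^ p) ^ (1 / p)) := by
        gcongr
        exact ENNReal.Lp_add_le _ _ _ hp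
    _ ≤ _ := by
        rw [hmul M]
        gcongr
        · exact hsum w₂
        · exact hsum w₃

end Partitions

/-! ### Moments of increments of processes in `BMO^{p-var}` -/

section BMO

variable {ι Ω : Type*} [LinearOrder ι] {mΩ : MeasurableSpace Ω} {𝓕 : Filtration ι mΩ}
  {P : Measure Ω} {V : ι → Ω → ℝ} {s t : ι}
  [TopologicalSpace ι] {p : ℝ} {K : ℝ≥0}

lemma MemBMOVar.measurable (hV : MemBMOVar 𝓕 P p V s t) (u : ι) : Measurable (V u) :=
  (hV.adapted u).measurable.mono (𝓕.le u) le_rfl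

lemma MemBMOVar.measurable_ofReal_exp (hV : MemBMOVar 𝓕 P p V s t) (c : ℝ) (u v : ι) :
    Measurable fun ω => ENNReal.ofReal (Real.exp (c * |V v ω - V u ω|)) :=
  ENNReal.measurable_ofReal.comp (Real.measurable_exp.comp
    ((measurable_abs_sub (fun u => (hV.adapted u).measurable) u v).const_mul c))

/-- Paths that are not càdlàg are replaced by zero; completeness puts this null set in every `𝓕 u`,
so adaptedness survives. -/
lemma MemBMOVar.exists_cadlag_modification (h𝓕 : UsualConditions 𝓕 P)
    (hV : MemBMOVar 𝓕 P p V s t) :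
    ∃ V' : ι → Ω → ℝ, (∀ u, Measurable[𝓕 u] (V' u)) ∧ (∀ ω, IsCadlag fun u => V' u ω) ∧
      ∀ᵐ ω ∂P, ∀ u, V' u ω = V u ω := by
  set G := {ω | IsCadlag fun u => V u ω} with hG
  have hG0 : P Gᶜ = 0 := hV.cadlag
  refine ⟨fun u => G.indicator (V u), fun u => ?_, fun ω => ?_, ?_⟩
  · have : MeasurableSet[𝓕 u] G := MeasurableSet.of_compl (h𝓕.complete u _ hG0)
    exact (hV.adapted u).measurable.indicator this
  · by_cases hω : ω ∈ G
    · simpa only [indicator_of_mem hω] using (show IsCadlag fun u => V u ω from hω)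
    · simp only [indicator_of_notMem hω]
      exact fun _ => ⟨continuousWithinAt_const, 0, tendsto_const_nhds⟩
  · filter_upwards [hV.cadlag] with ω hω u
    exact indicator_of_mem (s := G) hω _

/-- The bound for exponential moments of order `lam` of the increments of a process whose
`BMO^{p-var}` norm is at most `K`. -/
noncomputable def bmoExpConst (p lam : ℝ) (K : ℝ≥0) : ℝ≥0∞ :=
  expConst * (ENNReal.ofReal (Real.exp (lam * K)) * expConst) ^ ⌈(K : ℝ) ^ p * (6 * lam) ^ p⌉₊

lemma bmoExpConst_ne_top (p lam : ℝ) (K : ℝ≥0) : bmoExpConst p lam K ≠ ∞ :=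
  ENNReal.mul_ne_top expConst_ne_top
    (ENNReal.pow_ne_top (ENNReal.mul_ne_top ENNReal.ofReal_ne_top expConst_ne_top))

variable [OrderTopology ι] [DenselyOrdered ι] [SecondCountableTopology ι] [CompactSpace ι]

/-- The chaining lemma applies with `W u` the supremum of partition sums over `[u,t]` and `δ = (1 /
(6 * lam)) ^ p`. The norm bound `K` controls both the jumps and the total of `W`. -/
lemma MemBMOVar.setLIntegral_exp_le [IsProbabilityMeasure P] (h𝓕 : UsualConditions 𝓕 P)
    (hV : MemBMOVar 𝓕 P p V s t) (hK : bmoVarNorm 𝓕 P p V s t ≤ K) (hp : 1 ≤ p)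
    (hst : s < t) (hs : ∀ u, s ≤ u) (ht : ∀ u, u ≤ t) {lam : ℝ} (hlam : 0 < lam)
    {u v : ι} (huv : u ≤ v) {A : Set Ω} (hA : MeasurableSet[𝓕 u] A) :
    ∫⁻ ω in A, ENNReal.ofReal (Real.exp (lam * |V v ω - V u ω|)) ∂P ≤
      bmoExpConst p lam K * P A := by
  have hp0 : 0 < p := one_pos.trans_le hp
  obtain ⟨V', hV'm, hV'c, hVV'⟩ := hV.exists_cadlag_modification h𝓕
  have hmv : ∀ u v, u < v → meanVariation 𝓕 P V u v ≤ K := fun u v h =>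
    (le_pVariation hp0 (hs u) h (ht v)).trans hK
  have hjump : ∀ u, ∀ᵐ ω ∂P, |V' u ω - Function.leftLim (fun v => V' v ω) u| ≤ K := fun u => by
    filter_upwards [(meanVariationLE_of_meanVariation_le (hmv s t hst) hVV').jump_le hV'm hV'c
      (hs u) (ht u)] with ω hω
    rw [Real.enorm_eq_ofReal_abs, ← ENNReal.ofReal_coe_nnreal,
      ENNReal.ofReal_le_ofReal_iff K.coe_nonneg] at hω
    exact hω
  let w := meanVariation 𝓕 P V
  have hWK : ∀ u, partitionSup p w u t ≤ (K : ℝ≥0∞) ^ p := fun u =>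
    (partitionSup_antitone (hs u) (ht u)).trans (by
      rw [partitionSup_eq_pVariation_rpow hp0]
      exact ENNReal.rpow_le_rpow hK hp0.le)
  have hKtop : (K : ℝ≥0∞) ^ p ≠ ∞ := ENNReal.rpow_ne_top_of_nonneg hp0.le ENNReal.coe_ne_top
  have hWtop : ∀ u, partitionSup p w u t ≠ ∞ := fun u => ne_top_of_le_ne_top hKtop (hWK u)
  set W : ι → ℝ := fun u => (partitionSup p w u t).toReal with hWdef
  have hW : Antitone W := fun a b hab =>
    ENNReal.toReal_mono (hWtop a) (partitionSup_antitone hab (ht b))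
  have hδ : 0 ≤ (1 / (6 * lam)) ^ p := by positivity
  have hloc : ∀ u v, u < v → W u ≤ W v + (1 / (6 * lam)) ^ p →
      MeanVariationLE 𝓕 P V' u v (ENNReal.ofReal (1 / (6 * lam))) := fun u v huv h => by
    refine meanVariationLE_of_meanVariation_le ?_ hVV'
    rw [← ENNReal.rpow_le_rpow_iff hp0, ENNReal.ofReal_rpow_of_pos (by positivity)]
    have h1 : w u v ^ p + partitionSup p w v t ≤ partitionSup p w u t :=
      rpow_add_partitionSup_le huv (ht v)
    have h2 : partitionSup p w u t ≤
        ENNReal.ofReal ((1 / (6 * lam)) ^ p) + partitionSup p w v t := by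
      rw [← ENNReal.ofReal_toReal (hWtop u), ← ENNReal.ofReal_toReal (hWtop v),
        ← ENNReal.ofReal_add hδ ENNReal.toReal_nonneg, add_comm]
      exact ENNReal.ofReal_le_ofReal h
    exact (ENNReal.add_le_add_iff_right (hWtop v)).1 (h1.trans h2)
  -- Since `W u ≤ K ^ p`, the number of `δ`-steps needed is at most `K ^ p / δ = K ^ p * (6 * lam) ^
  -- p`, rounded up.
  have hN : ∀ u v, W u ≤ W v +
      ((⌈(K : ℝ) ^ p * (6 * lam) ^ p⌉₊ : ℝ) + 1) * (1 / (6 * lam)) ^ p := fun u v => by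
    have h1 : W u ≤ (K : ℝ) ^ p := by
      have := ENNReal.toReal_mono hKtop (hWK u)
      rwa [← ENNReal.toReal_rpow, ENNReal.coe_toReal] at this
    have h2 : 0 ≤ W v := ENNReal.toReal_nonneg
    have h3 : (K : ℝ) ^ p = (K : ℝ) ^ p * (6 * lam) ^ p * (1 / (6 * lam)) ^ p := by
      rw [mul_assoc, ← Real.mul_rpow (by positivity) (by positivity),
        mul_one_div_cancel (by positivity), Real.one_rpow, mul_one]
    have h4 : (K : ℝ) ^ p * (6 * lam) ^ p * (1 / (6 * lam)) ^ p ≤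
        (⌈(K : ℝ) ^ p * (6 * lam) ^ p⌉₊ + 1) * (1 / (6 * lam)) ^ p := by
      gcongr
      linarith [Nat.le_ceil ((K : ℝ) ^ p * (6 * lam) ^ p)]
    linarith
  have main := setLIntegral_exp_le_of_control hlam K.coe_nonneg h𝓕.rightCont hV'm hV'c hjump hW hδ hloc
    ⌈(K : ℝ) ^ p * (6 * lam) ^ p⌉₊ u v huv (hN u v) A hA
  refine le_trans (le_of_eq ?_) main
  refine lintegral_congr_ae (ae_restrict_of_ae ?_)
  filter_upwards [hVV'] with ω hω
  simp only [hω]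

lemma MemBMOVar.setLIntegral_rpow_le [IsProbabilityMeasure P] (h𝓕 : UsualConditions 𝓕 P)
    (hV : MemBMOVar 𝓕 P p V s t) (hp : 1 ≤ p)
    (hs : ∀ u, s ≤ u) (ht : ∀ u, u ≤ t) {m : ℝ} (hm : 0 < m)
    {u v : ι} (huv : u < v) {A : Set Ω} (hA : MeasurableSet[𝓕 u] A) :
    ∫⁻ ω in A, ‖V v ω - V u ω‖ₑ ^ m ∂P ≤
      momentConst m * meanVariation 𝓕 P V u v ^ m * P A := by
  obtain ⟨V', hV'm, hV'c, hVV'⟩ := hV.exists_cadlag_modification h𝓕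
  have htop : meanVariation 𝓕 P V u v ≠ ∞ := ne_top_of_le_ne_top hV.norm_lt_top.ne
    (le_pVariation (one_pos.trans_le hp) (hs u) huv (ht v))
  have main := (meanVariationLE_of_meanVariation_le le_rfl hVV').setLIntegral_rpow_le hm htop
    h𝓕.rightCont hV'm hV'c huv.le hA
  refine le_trans (le_of_eq ?_) main
  refine lintegral_congr_ae (ae_restrict_of_ae ?_)
  filter_upwards [hVV'] with ω hω
  simp only [hω]

end BMO

/-! ### Conditional Hölder inequality -/

section Conditional

variable {Ω : Type*} {𝒢 mΩ : MeasurableSpace Ω} {P : Measure Ω} [IsProbabilityMeasure P]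

lemma condLExp_le_of_forall_setLIntegral_le (h𝒢 : 𝒢 ≤ mΩ) {f g : Ω → ℝ≥0∞}
    (hg : Measurable[𝒢] g)
    (h : ∀ A, MeasurableSet[𝒢] A → ∫⁻ ω in A, f ω ∂P ≤ ∫⁻ ω in A, g ω ∂P) :
    condLExp 𝒢 P f ≤ᵐ[P] g := by
  refine ae_le_of_ae_le_trim (hm := h𝒢) ?_
  refine ae_le_of_forall_setLIntegral_le_of_sigmaFinite (μ := P.trim h𝒢)
    (measurable_condLExp _ _ _) ?_
  intro A hA _
  rw [setLIntegral_condLExp_trim h𝒢 _ _ hA, setLIntegral_trim h𝒢 hg hA]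
  exact h A hA

/-- Conditional Hölder inequality, up to a constant, when one factor has bounded conditional
moments. -/
lemma setLIntegral_mul_le_condLExp_rpow (h𝒢 : 𝒢 ≤ mΩ) {a b : ℝ} (hab : a.HolderConjugate b)
    {X Y : Ω → ℝ≥0∞} (hX : Measurable X) (hY : Measurable Y) {C : ℝ≥0∞}
    (hC : ∀ A, MeasurableSet[𝒢] A → ∫⁻ ω in A, Y ω ^ b ∂P ≤ C * P A)
    {A : Set Ω} (hA : MeasurableSet[𝒢] A) :
    ∫⁻ ω in A, X ω * Y ω ∂P ≤
      ∫⁻ ω in A, (1 + C) * condLExp 𝒢 P (fun ω => X ω ^ a) ω ^ (1 / a) ∂P := by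
  have ha := hab.pos
  have hb := hab.symm.pos
  set Z := condLExp 𝒢 P (fun ω => X ω ^ a) with hZdef
  have hZ : Measurable[𝒢] Z := measurable_condLExp _ _ _
  have hZ' : Measurable Z := hZ.mono h𝒢 le_rfl
  have hXa : Measurable fun ω => X ω ^ a := hX.pow_const a
  have hYb : Measurable fun ω => Y ω ^ b := hY.pow_const b
  have hint : ∀ B, MeasurableSet[𝒢] B → ∫⁻ ω in B, X ω ^ a ∂P = ∫⁻ ω in B, Z ω ∂P :=
    fun B hB => (setLIntegral_condLExp h𝒢 P _ hB).symm
  have hX0 : ∀ᵐ ω ∂P, Z ω = 0 → X ω = 0 := by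
    have hB : MeasurableSet[𝒢] {ω | Z ω = 0} := hZ (measurableSet_singleton 0)
    have h0 : ∫⁻ ω in {ω | Z ω = 0}, X ω ^ a ∂P = 0 := by
      rw [hint _ hB]
      exact (setLIntegral_congr_fun (h𝒢 _ hB) (fun ω hω => hω)).trans lintegral_zero
    rw [lintegral_eq_zero_iff hXa] at h0
    have := (ae_restrict_iff' (h𝒢 _ hB)).1 h0
    filter_upwards [this] with ω hω hz
    simpa [ENNReal.rpow_eq_zero_iff, ha, ha.le, not_lt.2 ha.le] using hω hz
  -- Young's inequality for `X / c` and `Y` with `c = Z ^ (1 / a)`, dropping the factors `1 / a` and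
  -- `1 / b`; this is why the constant is `1 + C`. Where `Z = 0`, `X` vanishes almost surely; where
  -- `Z = ∞`, the right side is infinite unless `Y = 0`.
  have hpt : ∀ᵐ ω ∂P, X ω * Y ω ≤
      Z ω ^ (1 / a - 1) * X ω ^ a + Z ω ^ (1 / a) * Y ω ^ b := by
    filter_upwards [hX0] with ω h0
    by_cases hz : Z ω = 0
    · simp [h0 hz]
    by_cases hzt : Z ω = ∞
    · by_cases hy : Y ω = 0
      · simp [hy]
      · have h1 : Z ω ^ (1 / a) = ∞ := by simp [hzt, ha]
        have h2 : Y ω ^ b ≠ 0 := by simp [ENNReal.rpow_eq_zero_iff, hy, hb.le]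
        rw [h1, ENNReal.top_mul h2]
        simp
    set c := Z ω ^ (1 / a) with hc
    have hc0 : c ≠ 0 := by simp [hc, ENNReal.rpow_eq_zero_iff, hz, hzt]
    have hct : c ≠ ∞ := ENNReal.rpow_ne_top_of_nonneg (by positivity) hzt
    have hZc : Z ω ^ (1 / a - 1) = c * c⁻¹ ^ a := by
      rw [hc, ENNReal.inv_rpow, ← ENNReal.rpow_mul, one_div_mul_cancel ha.ne', ENNReal.rpow_one,
        ENNReal.rpow_sub _ _ hz hzt, ENNReal.rpow_one, div_eq_mul_inv]
    calc X ω * Y ω = c * (c⁻¹ * X ω * Y ω) := by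
          rw [← mul_assoc, ← mul_assoc, ENNReal.mul_inv_cancel hc0 hct, one_mul]
      _ ≤ c * ((c⁻¹ * X ω) ^ a / ENNReal.ofReal a + Y ω ^ b / ENNReal.ofReal b) := by
          gcongr
          exact ENNReal.young_inequality _ _ hab
      _ ≤ c * ((c⁻¹ * X ω) ^ a + Y ω ^ b) := by
          gcongr
          · exact ENNReal.div_le_of_le_mul (le_mul_of_one_le_right' (by
              simpa using hab.lt.le))
          · exact ENNReal.div_le_of_le_mul (le_mul_of_one_le_right' (by
              simpa using hab.symm.lt.le))
      _ = _ := by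
          rw [hZc, ENNReal.mul_rpow_of_nonneg _ _ ha.le]
          ring
  have hZ1 : ∀ k : ℝ, Measurable[𝒢] fun ω => Z ω ^ k := fun k => hZ.pow_const k
  have hZ1' : ∀ k : ℝ, Measurable fun ω => Z ω ^ k := fun k => hZ'.pow_const k
  calc ∫⁻ ω in A, X ω * Y ω ∂P
      ≤ ∫⁻ ω in A, (Z ω ^ (1 / a - 1) * X ω ^ a + Z ω ^ (1 / a) * Y ω ^ b) ∂P :=
        lintegral_mono_ae (ae_restrict_of_ae hpt)
    _ = ∫⁻ ω in A, Z ω ^ (1 / a - 1) * X ω ^ a ∂P + ∫⁻ ω in A, Z ω ^ (1 / a) * Y ω ^ b ∂P :=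
        lintegral_add_left ((hZ1' _).mul hXa) _
    _ ≤ ∫⁻ ω in A, Z ω ^ (1 / a - 1) * Z ω ∂P + ∫⁻ ω in A, Z ω ^ (1 / a) * C ∂P := by
        refine add_le_add ?_ ?_
        · exact setLIntegral_mul_le_of_forall_setLIntegral_le h𝒢 hXa hZ' (hZ1 _)
            (fun B hB => (hint B hB).le) hA
        · exact setLIntegral_mul_le_of_forall_setLIntegral_le h𝒢 hYb measurable_const (hZ1 _)
            (fun B hB => by simpa using hC B hB) hA
    _ ≤ ∫⁻ ω in A, Z ω ^ (1 / a) ∂P + ∫⁻ ω in A, Z ω ^ (1 / a) * C ∂P := by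
        gcongr with ω
        by_cases hz : Z ω = 0
        · simp [hz]
        -- The exponent `1 / a - 1` is negative, so the product is `0 * ∞ = 0`.
        by_cases hzt : Z ω = ∞
        · simp [hzt, ENNReal.top_rpow_of_neg (show a⁻¹ - 1 < 0 by
            linarith [inv_lt_one_of_one_lt₀ hab.lt])]
        rw [ENNReal.rpow_sub _ _ hz hzt, ENNReal.rpow_one, ENNReal.div_mul_cancel hz hzt]
    _ = ∫⁻ ω in A, (Z ω ^ (1 / a) + Z ω ^ (1 / a) * C) ∂P :=
        (lintegral_add_left (hZ1' _) _).symm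
    _ = _ := by
        refine lintegral_congr fun ω => ?_
        ring

end Conditional

/-! ### `L^r` norms of `[0,∞]`-valued functions -/

section LpNorms

variable {Ω : Type*} {mΩ : MeasurableSpace Ω} {P : Measure Ω}

lemma eLpNorm_ofReal_eq {E : Type*} [ENorm E] [TopologicalSpace E] {r : ℝ} (hr : 0 < r)
    (f : Ω → E) :
    eLpNorm f (ENNReal.ofReal r) P = (∫⁻ ω, ‖f ω‖ₑ ^ r ∂P) ^ (1 / r) := by
  rw [eLpNorm_eq_lintegral_rpow_enorm_toReal (by simpa using hr) ENNReal.ofReal_ne_top,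
    ENNReal.toReal_ofReal hr.le]

lemma eLpNorm_ennreal_ofReal_eq {r : ℝ} (hr : 0 < r) (f : Ω → ℝ≥0∞) :
    eLpNorm f (ENNReal.ofReal r) P = (∫⁻ ω, f ω ^ r ∂P) ^ (1 / r) := by
  simp [eLpNorm_ofReal_eq hr]

lemma eLpNorm_ennreal_const_mul {r : ℝ} (hr : 0 < r) {f : Ω → ℝ≥0∞} (hf : Measurable f)
    (c : ℝ≥0∞) :
    eLpNorm (fun ω => c * f ω) (ENNReal.ofReal r) P = c * eLpNorm f (ENNReal.ofReal r) P := by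
  rw [eLpNorm_ennreal_ofReal_eq hr, eLpNorm_ennreal_ofReal_eq hr]
  simp only [ENNReal.mul_rpow_of_nonneg _ _ hr.le]
  rw [lintegral_const_mul _ (hf.pow_const r), ENNReal.mul_rpow_of_nonneg _ _ (by positivity),
    ← ENNReal.rpow_mul, mul_one_div_cancel hr.ne', ENNReal.rpow_one]

lemma eLpNorm_ennreal_rpow {r k : ℝ} (hr : 0 < r) (hk : 0 < k) (f : Ω → ℝ≥0∞) :
    eLpNorm (fun ω => f ω ^ k) (ENNReal.ofReal r) P =
      eLpNorm f (ENNReal.ofReal (k * r)) P ^ k := by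
  rw [eLpNorm_ennreal_ofReal_eq hr, eLpNorm_ennreal_ofReal_eq (by positivity)]
  simp only [← ENNReal.rpow_mul]
  congr 1
  field_simp

lemma eLpNorm_ennreal_mul_le {r a b : ℝ} (hr : 0 < r) (hab : a.HolderConjugate b)
    {f g : Ω → ℝ≥0∞} (hf : Measurable f) (hg : Measurable g) :
    eLpNorm (fun ω => f ω * g ω) (ENNReal.ofReal r) P ≤
      (∫⁻ ω, f ω ^ (r * b) ∂P) ^ (1 / (r * b)) * eLpNorm g (ENNReal.ofReal (a * r)) P := by
  have ha := hab.pos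
  have hb := hab.symm.pos
  rw [eLpNorm_ennreal_ofReal_eq hr, eLpNorm_ennreal_ofReal_eq (by positivity)]
  simp only [ENNReal.mul_rpow_of_nonneg _ _ hr.le]
  have h := ENNReal.lintegral_mul_le_Lp_mul_Lq P hab.symm (hf.pow_const r).aemeasurable
    (hg.pow_const r).aemeasurable
  calc (∫⁻ ω, f ω ^ r * g ω ^ r ∂P) ^ (1 / r)
      ≤ ((∫⁻ ω, (f ω ^ r) ^ b ∂P) ^ (1 / b) * (∫⁻ ω, (g ω ^ r) ^ a ∂P) ^ (1 / a)) ^ (1 / r) := by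
        gcongr
        exact h
    _ = _ := by
        rw [ENNReal.mul_rpow_of_nonneg _ _ (by positivity)]
        simp only [← ENNReal.rpow_mul]
        congr 2
        · field_simp
        · rw [mul_comm r a]
        · field_simp

end LpNorms

/-! ### The conditional norm of a controlled increment -/

section CondNorm

variable {Ω : Type*} {𝒢 mΩ : MeasurableSpace Ω} {P : Measure Ω} [IsProbabilityMeasure P]

/-- The constant in `condNorm_le_of_enorm_le`. -/
noncomputable def condNormConst (q q' r : ℝ) (C₁ C₂ : ℝ≥0∞) (M : ℝ → ℝ≥0∞) : ℝ≥0∞ :=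
  (2 ^ (q' - 1)) ^ (1 / q') *
    (((1 + C₁) * M (q' * (r * (q / q').conjExponent)) ^ (1 / (r * (q / q').conjExponent)))
        ^ (1 / q') +
      (C₂ * M (q' * (r * (q / (q' * r)).conjExponent)) ^ (1 / (r * (q / (q' * r)).conjExponent)))
        ^ (1 / q'))

lemma condNormConst_ne_top {q q' r : ℝ} (hq' : 1 ≤ q') (hr : 1 ≤ r) (hqq' : q' * r < q)
    {C₁ C₂ : ℝ≥0∞} {M : ℝ → ℝ≥0∞} (hC₁ : C₁ ≠ ∞) (hC₂ : C₂ ≠ ∞) (hM : ∀ m, M m ≠ ∞) :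
    condNormConst q q' r C₁ C₂ M ≠ ∞ := by
  have h1 : 1 < q / q' := by
    rw [one_lt_div (by linarith)]
    nlinarith
  have h2 : 1 < q / (q' * r) := by rwa [one_lt_div (by positivity)]
  have e1 := (Real.HolderConjugate.conjExponent h1).symm.pos
  have e2 := (Real.HolderConjugate.conjExponent h2).symm.pos
  have hq0 : 0 ≤ 1 / q' := by positivity
  unfold condNormConst
  refine ENNReal.mul_ne_top (ENNReal.rpow_ne_top_of_nonneg hq0
    (ENNReal.rpow_ne_top_of_nonneg (by linarith) (by simp))) (ENNReal.add_ne_top.2 ⟨?_, ?_⟩)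
  · refine ENNReal.rpow_ne_top_of_nonneg hq0 (ENNReal.mul_ne_top (by simpa using hC₁)
      (ENNReal.rpow_ne_top_of_nonneg (by positivity) (hM _)))
  · refine ENNReal.rpow_ne_top_of_nonneg hq0 (ENNReal.mul_ne_top hC₂
      (ENNReal.rpow_ne_top_of_nonneg (by positivity) (hM _)))

/-- Conditioning removes `Y₁` (by conditional Hölder) and `Y₂` (directly), leaving `𝒢`-measurable
factors. Hölder in `L^r` then removes the weight `ξ`, all of whose moments are bounded. -/
lemma condNorm_le_of_enorm_le (h𝒢 : 𝒢 ≤ mΩ) {q q' r : ℝ} (hq' : 1 ≤ q') (hr : 1 ≤ r)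
    (hqq' : q' * r < q) {F D D₀ : Ω → ℝ} {ξ Y₁ Y₂ : Ω → ℝ≥0∞}
    (hD : Measurable D) (hD₀ : Measurable[𝒢] D₀) (hξ : Measurable[𝒢] ξ)
    (hY₁ : Measurable Y₁) (hY₂ : Measurable Y₂)
    (hF : ∀ ω, ‖F ω‖ₑ ≤ ξ ω * (‖D ω‖ₑ * Y₁ ω + ‖D₀ ω‖ₑ * Y₂ ω)) {C₁ C₂ ρ : ℝ≥0∞} {M : ℝ → ℝ≥0∞}
    (h₁ : ∀ A, MeasurableSet[𝒢] A →
      ∫⁻ ω in A, Y₁ ω ^ (q' * (q / q').conjExponent) ∂P ≤ C₁ * P A)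
    (h₂ : ∀ A, MeasurableSet[𝒢] A → ∫⁻ ω in A, Y₂ ω ^ q' ∂P ≤ C₂ * ρ ^ q' * P A)
    (hM : ∀ m, 0 < m → ∫⁻ ω, ξ ω ^ m ∂P ≤ M m) :
    condNorm P q' (ENNReal.ofReal r) 𝒢 F ≤ condNormConst q q' r C₁ C₂ M *
      (condNorm P q (ENNReal.ofReal r) 𝒢 D + ρ * eLpNorm D₀ (ENNReal.ofReal q) P) := by
  have hq'0 : 0 < q' := by linarith
  have hr0 : 0 < r := by linarith
  have ha1 : 1 < q / q' := by
    rw [one_lt_div (by linarith)]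
    nlinarith
  have ha2 : 1 < q / (q' * r) := by rwa [one_lt_div (by positivity)]
  have hq0 : 0 < q := by nlinarith
  set a := q / q' with ha
  set b := a.conjExponent with hb
  set a' := q / (q' * r) with ha'
  set b' := a'.conjExponent with hb'
  have hab : a.HolderConjugate b := Real.HolderConjugate.conjExponent ha1
  have hab' : a'.HolderConjugate b' := Real.HolderConjugate.conjExponent ha2
  have hbp := hab.symm.pos
  have hb'p := hab'.symm.pos
  have hap := hab.pos
  have hξ' : Measurable ξ := hξ.mono h𝒢 le_rfl
  have hD₀' : Measurable D₀ := hD₀.mono h𝒢 le_rfl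
  set Z := condLExp 𝒢 P (fun ω => ‖D ω‖ₑ ^ q) with hZdef
  have hZ : Measurable[𝒢] Z := measurable_condLExp _ _ _
  have hZ' : Measurable Z := hZ.mono h𝒢 le_rfl
  have hDe : Measurable fun ω => ‖D ω‖ₑ := hD.enorm
  have hD₀e : Measurable[𝒢] fun ω => ‖D₀ ω‖ₑ := measurable_enorm.comp hD₀
  have hD₀e' : Measurable fun ω => ‖D₀ ω‖ₑ := hD₀'.enorm
  set G₁ : Ω → ℝ≥0∞ := fun ω => ξ ω ^ q' * Z ω ^ (1 / a) with hG₁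
  set G₂ : Ω → ℝ≥0∞ := fun ω => ξ ω ^ q' * ‖D₀ ω‖ₑ ^ q' with hG₂
  have hG₁m : Measurable[𝒢] G₁ := (hξ.pow_const q').mul (hZ.pow_const _)
  have hG₂m : Measurable[𝒢] G₂ := (hξ.pow_const q').mul (hD₀e.pow_const _)
  have hG₁m' : Measurable G₁ := hG₁m.mono h𝒢 le_rfl
  have hG₂m' : Measurable G₂ := hG₂m.mono h𝒢 le_rfl
  have hX : Measurable fun ω => ‖D ω‖ₑ ^ q' * Y₁ ω ^ q' :=
    (hDe.pow_const q').mul (hY₁.pow_const q')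
  have hY₂q : Measurable fun ω => Y₂ ω ^ q' := hY₂.pow_const q'
  set H : Ω → ℝ≥0∞ := fun ω => 2 ^ (q' - 1) * ((1 + C₁) * G₁ ω + C₂ * ρ ^ q' * G₂ ω) with hH
  have hHm : Measurable[𝒢] H := ((hG₁m.const_mul _).add (hG₂m.const_mul _)).const_mul _
  have hcond : condLExp 𝒢 P (fun ω => ‖F ω‖ₑ ^ q') ≤ᵐ[P] H := by
    refine condLExp_le_of_forall_setLIntegral_le h𝒢 hHm fun A hA => ?_
    have i1 : ∫⁻ ω in A, ξ ω ^ q' * (‖D ω‖ₑ ^ q' * Y₁ ω ^ q') ∂P ≤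
        ∫⁻ ω in A, (1 + C₁) * G₁ ω ∂P := by
      have := setLIntegral_mul_le_of_forall_setLIntegral_le (P := P) h𝒢 hX
        (Y' := fun ω => (1 + C₁) * Z ω ^ (1 / a)) ((hZ'.pow_const _).const_mul _)
        (hξ.pow_const q') (fun B hB => ?_) hA
      · refine this.trans_eq (lintegral_congr fun ω => ?_)
        rw [hG₁]
        ring
      · have := setLIntegral_mul_le_condLExp_rpow h𝒢 (P := P) hab (hDe.pow_const q')
          (hY₁.pow_const q') (C := C₁) (fun B hB => ?_) hB
        · refine this.trans_eq (lintegral_congr fun ω => ?_)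
          simp only [← ENNReal.rpow_mul]
          rw [hZdef, ha, mul_div_cancel₀ _ hq'0.ne']
        · simpa only [← ENNReal.rpow_mul] using h₁ B hB
    have i2 : ∫⁻ ω in A, G₂ ω * Y₂ ω ^ q' ∂P ≤ ∫⁻ ω in A, C₂ * ρ ^ q' * G₂ ω ∂P := by
      have := setLIntegral_mul_le_of_forall_setLIntegral_le (P := P) h𝒢 hY₂q
        (Y' := fun _ => C₂ * ρ ^ q') measurable_const hG₂m (fun B hB => by simpa using h₂ B hB) hA
      simpa only [mul_comm] using this
    calc ∫⁻ ω in A, ‖F ω‖ₑ ^ q' ∂P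
        ≤ ∫⁻ ω in A, 2 ^ (q' - 1) *
            (ξ ω ^ q' * (‖D ω‖ₑ ^ q' * Y₁ ω ^ q') + G₂ ω * Y₂ ω ^ q') ∂P := by
          refine lintegral_mono fun ω => ?_
          calc ‖F ω‖ₑ ^ q' ≤ (ξ ω * ‖D ω‖ₑ * Y₁ ω + ξ ω * ‖D₀ ω‖ₑ * Y₂ ω) ^ q' := by
                gcongr
                refine (hF ω).trans_eq ?_
                ring
            _ ≤ _ := ENNReal.rpow_add_le_mul_rpow_add_rpow _ _ hq'
            _ = _ := by
                simp only [hG₂, ENNReal.mul_rpow_of_nonneg _ _ hq'0.le]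
                ring
      _ = 2 ^ (q' - 1) * (∫⁻ ω in A, ξ ω ^ q' * (‖D ω‖ₑ ^ q' * Y₁ ω ^ q') ∂P +
            ∫⁻ ω in A, G₂ ω * Y₂ ω ^ q' ∂P) :=
          (lintegral_const_mul _ (((hξ'.pow_const q').mul hX).add (hG₂m'.mul hY₂q))).trans
            (congrArg _ (lintegral_add_left ((hξ'.pow_const q').mul hX) _))
      _ ≤ 2 ^ (q' - 1) * (∫⁻ ω in A, (1 + C₁) * G₁ ω ∂P +
            ∫⁻ ω in A, C₂ * ρ ^ q' * G₂ ω ∂P) := by gcongr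
      _ = _ := ((lintegral_const_mul _ ((hG₁m'.const_mul _).add (hG₂m'.const_mul _))).trans
            (congrArg _ (lintegral_add_left (hG₁m'.const_mul _) _))).symm
  -- With `a = q / q'`, the norm of `Z ^ (1 / a)` in `L^{a r}` is exactly a power of the norm of `Z`
  -- in `L^r`.
  have hN₁ : eLpNorm G₁ (ENNReal.ofReal r) P ≤
      M (q' * (r * b)) ^ (1 / (r * b)) * eLpNorm Z (ENNReal.ofReal r) P ^ (1 / a) := by
    refine (eLpNorm_ennreal_mul_le hr0 hab (hξ'.pow_const q') (hZ'.pow_const _)).trans ?_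
    gcongr
    · simp only [← ENNReal.rpow_mul]
      exact hM _ (by positivity)
    · rw [eLpNorm_ennreal_rpow (by positivity) (by positivity), ← mul_assoc,
        one_div_mul_cancel hap.ne', one_mul]
  -- Here `a' = q / (q' * r)` is chosen so that `q' * a' * r = q`; it exceeds `1` precisely because
  -- `q' * r < q`.
  have hN₂ : eLpNorm G₂ (ENNReal.ofReal r) P ≤
      M (q' * (r * b')) ^ (1 / (r * b')) * eLpNorm D₀ (ENNReal.ofReal q) P ^ q' := by
    refine (eLpNorm_ennreal_mul_le hr0 hab' (hξ'.pow_const q') (hD₀e'.pow_const _)).trans ?_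
    gcongr
    · simp only [← ENNReal.rpow_mul]
      exact hM _ (by positivity)
    · rw [eLpNorm_ennreal_rpow (by positivity) (by positivity),
        show q' * (a' * r) = q by rw [ha']; field_simp, eLpNorm_enorm]
  have hmain : eLpNorm (condLExp 𝒢 P (fun ω => ‖F ω‖ₑ ^ q')) (ENNReal.ofReal r) P ≤
      2 ^ (q' - 1) * ((1 + C₁) * M (q' * (r * b)) ^ (1 / (r * b)) *
          eLpNorm Z (ENNReal.ofReal r) P ^ (1 / a) +
        C₂ * M (q' * (r * b')) ^ (1 / (r * b')) *
          (ρ * eLpNorm D₀ (ENNReal.ofReal q) P) ^ q') := by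
    calc _ ≤ eLpNorm H (ENNReal.ofReal r) P := by
          refine eLpNorm_mono_enorm_ae ?_
          filter_upwards [hcond] with ω hω
          simpa using hω
      _ = 2 ^ (q' - 1) * eLpNorm (fun ω => (1 + C₁) * G₁ ω + C₂ * ρ ^ q' * G₂ ω)
            (ENNReal.ofReal r) P :=
          eLpNorm_ennreal_const_mul hr0 ((hG₁m'.const_mul _).add (hG₂m'.const_mul _)) _
      _ ≤ 2 ^ (q' - 1) * (eLpNorm (fun ω => (1 + C₁) * G₁ ω) (ENNReal.ofReal r) P +
            eLpNorm (fun ω => C₂ * ρ ^ q' * G₂ ω) (ENNReal.ofReal r) P) := by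
          gcongr
          exact eLpNorm_add_le (hG₁m'.const_mul _).aestronglyMeasurable
            (hG₂m'.const_mul _).aestronglyMeasurable (by simpa using hr)
      _ ≤ 2 ^ (q' - 1) * ((1 + C₁) * (M (q' * (r * b)) ^ (1 / (r * b)) *
            eLpNorm Z (ENNReal.ofReal r) P ^ (1 / a)) +
          C₂ * ρ ^ q' * (M (q' * (r * b')) ^ (1 / (r * b')) *
            eLpNorm D₀ (ENNReal.ofReal q) P ^ q')) := by
          rw [eLpNorm_ennreal_const_mul hr0 hG₁m', eLpNorm_ennreal_const_mul hr0 hG₂m']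
          gcongr
      _ = _ := by
          rw [ENNReal.mul_rpow_of_nonneg _ _ hq'0.le]
          ring
  have hq'i : 0 ≤ 1 / q' := by positivity
  calc condNorm P q' (ENNReal.ofReal r) 𝒢 F ≤ _ := ENNReal.rpow_le_rpow hmain hq'i
    _ ≤ (2 ^ (q' - 1)) ^ (1 / q') * (((1 + C₁) * M (q' * (r * b)) ^ (1 / (r * b))) ^ (1 / q') *
          condNorm P q (ENNReal.ofReal r) 𝒢 D +
        (C₂ * M (q' * (r * b')) ^ (1 / (r * b'))) ^ (1 / q') *
          (ρ * eLpNorm D₀ (ENNReal.ofReal q) P)) := by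
        rw [ENNReal.mul_rpow_of_nonneg _ _ hq'i]
        gcongr
        refine (ENNReal.rpow_add_le_add_rpow _ _ hq'i ?_).trans_eq ?_
        · rw [div_le_one hq'0]
          exact hq'
        · rw [ENNReal.mul_rpow_of_nonneg _ _ hq'i, ENNReal.mul_rpow_of_nonneg (C₂ * _) _ hq'i,
            ← ENNReal.rpow_mul, ← ENNReal.rpow_mul, mul_one_div_cancel hq'0.ne', ENNReal.rpow_one,
            condNorm, show 1 / a * (1 / q') = 1 / q by rw [ha]; field_simp]
    _ ≤ _ := by
        rw [condNormConst, mul_assoc]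
        refine mul_le_mul_right ?_ _
        rw [mul_add]
        exact add_le_add (mul_le_mul' le_self_add le_rfl) (mul_le_mul' le_add_self le_rfl)

end CondNorm

/-! ### Elementary inequalities for the exponential -/

section Exponential

lemma abs_exp_sub_exp_le (x y : ℝ) :
    |Real.exp x - Real.exp y| ≤ |x - y| * Real.exp (|x| + |y|) := by
  wlog hxy : y ≤ x generalizing x y
  · rw [abs_sub_comm, abs_sub_comm x, add_comm]
    exact this y x (not_le.1 hxy).le
  rw [abs_of_nonneg (sub_nonneg.2 (Real.exp_le_exp.2 hxy)), abs_of_nonneg (sub_nonneg.2 hxy)]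
  have h1 : Real.exp x - Real.exp y ≤ (x - y) * Real.exp x := by
    have := Real.add_one_le_exp (y - x)
    have h2 : Real.exp y = Real.exp x * Real.exp (y - x) := by rw [← Real.exp_add]; ring_nf
    rw [h2]
    nlinarith [Real.exp_pos x]
  refine h1.trans (mul_le_mul_of_nonneg_left (Real.exp_le_exp.2 ?_) (sub_nonneg.2 hxy))
  linarith [le_abs_self x, abs_nonneg y]

/-- The wasteful exponent `|x| + |x|` gives this the shape required by `condNorm_le_of_exp_bound`
when `V' = V`. -/
lemma abs_exp_increment_le (x y : ℝ) :
    |Real.exp y - Real.exp x| ≤ Real.exp (|x| + |x|) * (|y - x| * Real.exp |y - x|) := by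
  have h : Real.exp y - Real.exp x = Real.exp x * (Real.exp (y - x) - Real.exp 0) := by
    rw [mul_sub, ← Real.exp_add, ← Real.exp_add]
    ring_nf
  rw [h, abs_mul, Real.abs_exp]
  gcongr
  · linarith [le_abs_self x, abs_nonneg x]
  · simpa using abs_exp_sub_exp_le (y - x) 0

/-- Factor out the starting values: with `d = y - x` and `d' = y' - x'`, the left side is `e^x (e^d
- e^{d'}) + (e^x - e^{x'}) (e^{d'} - 1)`, and each difference of exponentials is bounded by
`abs_exp_sub_exp_le`. -/
lemma abs_exp_sub_exp_increment_le (x y x' y' : ℝ) :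
    |(Real.exp y - Real.exp y') - (Real.exp x - Real.exp x')| ≤
      Real.exp (|x| + |x'|) * (|(y - y') - (x - x')| * Real.exp (|y - x| + |y' - x'|) +
        |x - x'| * (|y' - x'| * Real.exp |y' - x'|)) := by
  have h : (Real.exp y - Real.exp y') - (Real.exp x - Real.exp x') =
      Real.exp x * (Real.exp (y - x) - Real.exp (y' - x')) +
        (Real.exp x - Real.exp x') * (Real.exp (y' - x') - Real.exp 0) := by
    have h1 : Real.exp y = Real.exp x * Real.exp (y - x) := by rw [← Real.exp_add]; ring_nf
    have h2 : Real.exp y' = Real.exp x' * Real.exp (y' - x') := by rw [← Real.exp_add]; ring_nf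
    rw [h1, h2, Real.exp_zero]
    ring
  have e1 := abs_exp_sub_exp_le (y - x) (y' - x')
  have e2 : |Real.exp (y' - x') - Real.exp 0| ≤ |y' - x'| * Real.exp |y' - x'| := by
    simpa using abs_exp_sub_exp_le (y' - x') 0
  have e3 := abs_exp_sub_exp_le x x'
  have e4 : Real.exp x ≤ Real.exp (|x| + |x'|) :=
    Real.exp_le_exp.2 (by linarith [le_abs_self x, abs_nonneg x'])
  rw [show y - x - (y' - x') = y - y' - (x - x') by ring] at e1
  calc _ ≤ Real.exp x * |Real.exp (y - x) - Real.exp (y' - x')| +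
        |Real.exp x - Real.exp x'| * |Real.exp (y' - x') - Real.exp 0| := by
        rw [h]
        refine (abs_add_le _ _).trans_eq ?_
        rw [abs_mul, abs_mul, Real.abs_exp]
    _ ≤ Real.exp (|x| + |x'|) * (|y - y' - (x - x')| * Real.exp (|y - x| + |y' - x'|)) +
        |x - x'| * Real.exp (|x| + |x'|) * (|y' - x'| * Real.exp |y' - x'|) := by gcongr
    _ = _ := by ring

lemma ofReal_exp_rpow (x m : ℝ) :
    ENNReal.ofReal (Real.exp x) ^ m = ENNReal.ofReal (Real.exp (m * x)) := by
  rw [ENNReal.ofReal_rpow_of_pos (Real.exp_pos _), ← Real.exp_mul, mul_comm]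

lemma ofReal_exp_add_rpow_le {m : ℝ} (hm : 0 ≤ m) (x y : ℝ) :
    ENNReal.ofReal (Real.exp (x + y)) ^ m ≤
      ENNReal.ofReal (Real.exp (2 * m * x)) + ENNReal.ofReal (Real.exp (2 * m * y)) := by
  rw [ofReal_exp_rpow]
  rcases le_total x y with h | h
  · refine le_trans (ENNReal.ofReal_le_ofReal (Real.exp_le_exp.2 ?_)) le_add_self
    nlinarith
  · refine le_trans (ENNReal.ofReal_le_ofReal (Real.exp_le_exp.2 ?_)) le_self_add
    nlinarith

end Exponential

/-! ### Increments of exponentials of `BMO^{p-var}` processes -/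

section Increments

variable {ι Ω : Type*} [LinearOrder ι] {mΩ : MeasurableSpace Ω} {𝓕 : Filtration ι mΩ}
  {P : Measure Ω} [IsProbabilityMeasure P] {V V' : ι → Ω → ℝ} {s t u v : ι}

/-- The `L^q` norm of `D u - D s` is its conditional norm with `r = 1`, which increases with `r` on
a probability space and is one term of the `p`-variation. -/
lemma eLpNorm_le_add_pqrNorm {D : ι → Ω → ℝ} (hD : ∀ u, Measurable (D u)) {p q r : ℝ}
    (hp : 1 ≤ p) (hq : 1 ≤ q) (hr : 1 ≤ r) (hsu : s ≤ u) (hut : u ≤ t) :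
    eLpNorm (D u) (ENNReal.ofReal q) P ≤ eLpNorm (D s) (ENNReal.ofReal q) P +
      pqrNorm 𝓕 P p q (ENNReal.ofReal r) (increment D) s t := by
  rcases hsu.eq_or_lt with rfl | hlt
  · exact le_self_add
  have hq0 : 0 < q := by linarith
  have h1 : D u = D s + increment D s u := by
    ext ω
    simp [increment]
  have h2 : Measurable (increment D s u) := (hD u).sub (hD s)
  have h3 : eLpNorm (increment D s u) (ENNReal.ofReal q) P ≤
      pqrNorm 𝓕 P p q (ENNReal.ofReal r) (increment D) s t := by
    refine le_trans ?_ (le_pVariation (w := fun u v =>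
      condNorm P q (ENNReal.ofReal r) (𝓕 u) (increment D u v)) (by linarith) le_rfl hlt hut)
    rw [eLpNorm_ofReal_eq hq0, condNorm]
    refine ENNReal.rpow_le_rpow ?_ (by positivity)
    calc ∫⁻ ω, ‖increment D s u ω‖ₑ ^ q ∂P
        = eLpNorm (condLExp (𝓕 s) P fun ω => ‖increment D s u ω‖ₑ ^ q) 1 P := by
          rw [eLpNorm_one_eq_lintegral_enorm]
          simp [lintegral_condLExp (𝓕.le s)]
      _ ≤ _ := eLpNorm_le_eLpNorm_of_exponent_le (by simpa using hr)
          (measurable_condLExp' _ _ _).aestronglyMeasurable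
  rw [h1]
  exact (eLpNorm_add_le (hD s).aestronglyMeasurable h2.aestronglyMeasurable
    (by simpa using hq)).trans (by gcongr)

variable [TopologicalSpace ι] [OrderTopology ι] [DenselyOrdered ι] [SecondCountableTopology ι]
  [CompactSpace ι] {p : ℝ} {K K' K₀ K₀' : ℝ≥0}

/-- The bound for the moments of order `m` of `exp (|δV| + |δV'|)`. -/
noncomputable def incrementExpConst (p m : ℝ) (K K' : ℝ≥0) : ℝ≥0∞ :=
  bmoExpConst p (2 * m) K + bmoExpConst p (2 * m) K'

/-- The bound for the moments of order `m` of `|δV| exp |δV|`, relative to the mean variation. -/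
noncomputable def incrementMulExpConst (p m : ℝ) (K : ℝ≥0) : ℝ≥0∞ :=
  (1 + bmoExpConst p (2 * m) K) * momentConst (2 * m) ^ (1 / 2 : ℝ)

/-- The bound for the moments of order `m` of `exp (|V| + |V'|)`. -/
noncomputable def valueExpConst (p m : ℝ) (K₀ K₀' K K' : ℝ≥0) : ℝ≥0∞ :=
  ENNReal.ofReal (Real.exp (m * (K₀ + K₀'))) * incrementExpConst p m K K'

lemma incrementExpConst_ne_top (p m : ℝ) (K K' : ℝ≥0) : incrementExpConst p m K K' ≠ ∞ :=
  ENNReal.add_ne_top.2 ⟨bmoExpConst_ne_top _ _ _, bmoExpConst_ne_top _ _ _⟩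

lemma incrementMulExpConst_ne_top (p m : ℝ) (K : ℝ≥0) : incrementMulExpConst p m K ≠ ∞ :=
  ENNReal.mul_ne_top (ENNReal.add_ne_top.2 ⟨ENNReal.one_ne_top, bmoExpConst_ne_top _ _ _⟩)
    (ENNReal.rpow_ne_top_of_nonneg (by norm_num) (momentConst_ne_top _))

lemma valueExpConst_ne_top (p m : ℝ) (K₀ K₀' K K' : ℝ≥0) :
    valueExpConst p m K₀ K₀' K K' ≠ ∞ :=
  ENNReal.mul_ne_top ENNReal.ofReal_ne_top (incrementExpConst_ne_top _ _ _ _)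

lemma setLIntegral_exp_increments_le (h𝓕 : UsualConditions 𝓕 P)
    (hV : MemBMOVar 𝓕 P p V s t) (hK : bmoVarNorm 𝓕 P p V s t ≤ K)
    (hV' : MemBMOVar 𝓕 P p V' s t) (hK' : bmoVarNorm 𝓕 P p V' s t ≤ K') (hp : 1 ≤ p)
    (hst : s < t) (hs : ∀ u, s ≤ u) (ht : ∀ u, u ≤ t) {m : ℝ} (hm : 0 < m)
    (huv : u ≤ v) {A : Set Ω} (hA : MeasurableSet[𝓕 u] A) :
    ∫⁻ ω in A, ENNReal.ofReal (Real.exp (|V v ω - V u ω| + |V' v ω - V' u ω|)) ^ m ∂P ≤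
      incrementExpConst p m K K' * P A := by
  calc _ ≤ ∫⁻ ω in A, (ENNReal.ofReal (Real.exp (2 * m * |V v ω - V u ω|)) +
        ENNReal.ofReal (Real.exp (2 * m * |V' v ω - V' u ω|))) ∂P :=
        lintegral_mono fun ω => ofReal_exp_add_rpow_le hm.le _ _
    _ = _ := lintegral_add_left (hV.measurable_ofReal_exp (2 * m) u v) _
    _ ≤ bmoExpConst p (2 * m) K * P A + bmoExpConst p (2 * m) K' * P A :=
        add_le_add (hV.setLIntegral_exp_le h𝓕 hK hp hst hs ht (by positivity) huv hA)
          (hV'.setLIntegral_exp_le h𝓕 hK' hp hst hs ht (by positivity) huv hA)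
    _ = _ := by rw [incrementExpConst, add_mul]

/-- Conditional Cauchy–Schwarz: the moment of order `2 * m` supplies the power of the mean
variation, and the exponential moment only a constant. -/
lemma MemBMOVar.setLIntegral_mul_exp_le (h𝓕 : UsualConditions 𝓕 P)
    (hV : MemBMOVar 𝓕 P p V s t) (hK : bmoVarNorm 𝓕 P p V s t ≤ K) (hp : 1 ≤ p)
    (hst : s < t) (hs : ∀ u, s ≤ u) (ht : ∀ u, u ≤ t) {m : ℝ} (hm : 0 < m)
    (huv : u < v) {A : Set Ω} (hA : MeasurableSet[𝓕 u] A) :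
    ∫⁻ ω in A, (‖V v ω - V u ω‖ₑ * ENNReal.ofReal (Real.exp |V v ω - V u ω|)) ^ m ∂P ≤
      incrementMulExpConst p m K * meanVariation 𝓕 P V u v ^ m * P A := by
  have hX : Measurable fun ω => ‖V v ω - V u ω‖ₑ := ((hV.measurable v).sub (hV.measurable u)).enorm
  have h1 := setLIntegral_mul_le_condLExp_rpow (P := P) (𝓕.le u) Real.HolderConjugate.two_two
    (hX.pow_const m) (hV.measurable_ofReal_exp m u v) (C := bmoExpConst p (2 * m) K)
    (fun B hB => by
      simp only [ofReal_exp_rpow, ← mul_assoc]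
      exact hV.setLIntegral_exp_le h𝓕 hK hp hst hs ht (by positivity) huv.le hB) hA
  have h2 : condLExp (𝓕 u) P (fun ω => (‖V v ω - V u ω‖ₑ ^ m) ^ (2 : ℝ)) ≤ᵐ[P]
      fun _ => momentConst (2 * m) * meanVariation 𝓕 P V u v ^ (2 * m) := by
    refine condLExp_le_of_forall_setLIntegral_le (𝓕.le u) measurable_const fun B hB => ?_
    simp only [← ENNReal.rpow_mul, mul_comm m 2]
    simpa using hV.setLIntegral_rpow_le h𝓕 hp hs ht (by positivity) huv hB
  calc ∫⁻ ω in A, (‖V v ω - V u ω‖ₑ * ENNReal.ofReal (Real.exp |V v ω - V u ω|)) ^ m ∂P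
      = ∫⁻ ω in A, ‖V v ω - V u ω‖ₑ ^ m *
          ENNReal.ofReal (Real.exp (m * |V v ω - V u ω|)) ∂P := by
        refine lintegral_congr fun ω => ?_
        rw [ENNReal.mul_rpow_of_nonneg _ _ hm.le, ofReal_exp_rpow]
    _ ≤ _ := h1
    _ ≤ ∫⁻ _ in A, (1 + bmoExpConst p (2 * m) K) *
          (momentConst (2 * m) * meanVariation 𝓕 P V u v ^ (2 * m)) ^ (1 / 2 : ℝ) ∂P := by
        refine lintegral_mono_ae (ae_restrict_of_ae ?_)
        filter_upwards [h2] with ω hω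
        gcongr
    _ = _ := by
        rw [ENNReal.mul_rpow_of_nonneg _ _ (by norm_num), ← ENNReal.rpow_mul,
          show 2 * m * (1 / 2) = m by ring, incrementMulExpConst]
        simp [mul_assoc]

/-- The value at `u` is an essentially bounded initial value plus an increment over `[s,u]`, to
which the exponential bound applies. -/
lemma lintegral_exp_values_le (h𝓕 : UsualConditions 𝓕 P)
    (hV : MemBMOVar 𝓕 P p V s t) (hK : bmoVarNorm 𝓕 P p V s t ≤ K)
    (hV' : MemBMOVar 𝓕 P p V' s t) (hK' : bmoVarNorm 𝓕 P p V' s t ≤ K')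
    (hK₀ : eLpNorm (V s) ∞ P ≤ K₀) (hK₀' : eLpNorm (V' s) ∞ P ≤ K₀') (hp : 1 ≤ p)
    (hst : s < t) (hs : ∀ u, s ≤ u) (ht : ∀ u, u ≤ t) (u : ι) {m : ℝ} (hm : 0 < m) :
    ∫⁻ ω, ENNReal.ofReal (Real.exp (|V u ω| + |V' u ω|)) ^ m ∂P ≤
      valueExpConst p m K₀ K₀' K K' := by
  have hbound : ∀ (U : ι → Ω → ℝ) (k : ℝ≥0), eLpNorm (U s) ∞ P ≤ k →
      ∀ᵐ ω ∂P, |U s ω| ≤ k := fun U k hk => by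
    rw [eLpNorm_exponent_top] at hk
    filter_upwards [enorm_ae_le_eLpNormEssSup (U s) P] with ω hω
    have h1 := hω.trans hk
    rw [Real.enorm_eq_ofReal_abs, ← ENNReal.ofReal_coe_nnreal,
      ENNReal.ofReal_le_ofReal_iff k.coe_nonneg] at h1
    exact h1
  have h1 := setLIntegral_exp_increments_le h𝓕 hV hK hV' hK' hp hst hs ht hm (hs u)
    MeasurableSet.univ
  simp only [Measure.restrict_univ, measure_univ, mul_one] at h1
  calc _ ≤ ∫⁻ ω, ENNReal.ofReal (Real.exp (m * (K₀ + K₀'))) *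
        ENNReal.ofReal (Real.exp (|V u ω - V s ω| + |V' u ω - V' s ω|)) ^ m ∂P := by
        refine lintegral_mono_ae ?_
        filter_upwards [hbound V K₀ hK₀, hbound V' K₀' hK₀'] with ω h2 h3
        rw [← ofReal_exp_rpow, ← ENNReal.mul_rpow_of_nonneg _ _ hm.le,
          ← ENNReal.ofReal_mul (Real.exp_pos _).le, ← Real.exp_add]
        refine ENNReal.rpow_le_rpow (ENNReal.ofReal_le_ofReal (Real.exp_le_exp.2 ?_)) hm.le
        have h4 := abs_sub_abs_le_abs_sub (V u ω) (V s ω)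
        have h5 := abs_sub_abs_le_abs_sub (V' u ω) (V' s ω)
        linarith
    _ = _ := lintegral_const_mul' _ _ ENNReal.ofReal_ne_top
    _ ≤ _ := by
        rw [valueExpConst]
        gcongr

/-- The constant in the estimates for exponentials of processes in `BMO^{p-var}`. -/
noncomputable def expIncrementConst (p q q' r : ℝ) (K₀ K₀' K K' : ℝ≥0) : ℝ≥0∞ :=
  condNormConst q q' r (incrementExpConst p (q' * (q / q').conjExponent) K K')
    (incrementMulExpConst p q' K') (fun m => valueExpConst p m K₀ K₀' K K')

lemma expIncrementConst_ne_top {q q' r : ℝ} (hq' : 1 ≤ q') (hr : 1 ≤ r) (hqq' : q' * r < q)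
    (p : ℝ) (K₀ K₀' K K' : ℝ≥0) : expIncrementConst p q q' r K₀ K₀' K K' ≠ ∞ :=
  condNormConst_ne_top hq' hr hqq' (incrementExpConst_ne_top _ _ _ _)
    (incrementMulExpConst_ne_top _ _ _) fun _ => valueExpConst_ne_top _ _ _ _ _ _

/-- A process `F` whose increments are controlled like those of `exp V - exp V'`. -/
lemma condNorm_le_of_exp_bound (h𝓕 : UsualConditions 𝓕 P)
    (hV : MemBMOVar 𝓕 P p V s t) (hK : bmoVarNorm 𝓕 P p V s t ≤ K)
    (hV' : MemBMOVar 𝓕 P p V' s t) (hK' : bmoVarNorm 𝓕 P p V' s t ≤ K')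
    (hK₀ : eLpNorm (V s) ∞ P ≤ K₀) (hK₀' : eLpNorm (V' s) ∞ P ≤ K₀') (hp : 1 ≤ p)
    (hst : s < t) (hs : ∀ u, s ≤ u) (ht : ∀ u, u ≤ t) {q q' r : ℝ} (hq' : 1 ≤ q') (hr : 1 ≤ r)
    (hqq' : q' * r < q) (huv : u < v) {F D D₀ : Ω → ℝ} (hD : Measurable D)
    (hD₀ : Measurable[𝓕 u] D₀)
    (hF : ∀ ω, |F ω| ≤ Real.exp (|V u ω| + |V' u ω|) *
      (|D ω| * Real.exp (|V v ω - V u ω| + |V' v ω - V' u ω|) +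
        |D₀ ω| * (|V' v ω - V' u ω| * Real.exp |V' v ω - V' u ω|))) :
    condNorm P q' (ENNReal.ofReal r) (𝓕 u) F ≤ expIncrementConst p q q' r K₀ K₀' K K' *
      (condNorm P q (ENNReal.ofReal r) (𝓕 u) D +
        meanVariation 𝓕 P V' u v * eLpNorm D₀ (ENNReal.ofReal q) P) := by
  have ha1 : 1 < q / q' := by
    rw [one_lt_div (by linarith)]
    nlinarith
  have hb := (Real.HolderConjugate.conjExponent ha1).symm.pos
  have hVu : Measurable[𝓕 u] (V u) := (hV.adapted u).measurable
  have hVu' : Measurable[𝓕 u] (V' u) := (hV'.adapted u).measurable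
  have habs := measurable_abs_sub (fun u => (hV.adapted u).measurable) u v
  have habs' := measurable_abs_sub (fun u => (hV'.adapted u).measurable) u v
  have hofexp : Measurable fun x : ℝ => ENNReal.ofReal (Real.exp x) :=
    ENNReal.measurable_ofReal.comp Real.measurable_exp
  have hofabs : Continuous fun x : ℝ => |x| := continuous_abs
  refine condNorm_le_of_enorm_le (𝓕.le u) hq' hr hqq' hD hD₀
    (ξ := fun ω => ENNReal.ofReal (Real.exp (|V u ω| + |V' u ω|)))
    (Y₁ := fun ω => ENNReal.ofReal (Real.exp (|V v ω - V u ω| + |V' v ω - V' u ω|)))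
    (Y₂ := fun ω => ‖V' v ω - V' u ω‖ₑ * ENNReal.ofReal (Real.exp |V' v ω - V' u ω|))
    (hofexp.comp ((hofabs.measurable.comp hVu).add (hofabs.measurable.comp hVu')))
    (hofexp.comp (habs.add habs'))
    (((hV'.measurable v).sub (hV'.measurable u)).enorm.mul (hofexp.comp habs'))
    (fun ω => ?_) (fun A hA => ?_) (fun A hA => ?_) (fun m hm => ?_)
  · simp only [Real.enorm_eq_ofReal_abs]
    rw [← ENNReal.ofReal_mul (abs_nonneg _), ← ENNReal.ofReal_mul (abs_nonneg _),
      ← ENNReal.ofReal_mul (abs_nonneg _), ← ENNReal.ofReal_add (by positivity) (by positivity),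
      ← ENNReal.ofReal_mul (Real.exp_pos _).le]
    exact ENNReal.ofReal_le_ofReal (hF ω)
  · exact setLIntegral_exp_increments_le h𝓕 hV hK hV' hK' hp hst hs ht (by positivity) huv.le hA
  · exact hV'.setLIntegral_mul_exp_le h𝓕 hK' hp hst hs ht (by linarith) huv hA
  · exact lintegral_exp_values_le h𝓕 hV hK hV' hK' hK₀ hK₀' hp hst hs ht u hm

lemma MemBMOVar.pqrNorm_exp_lt_top (h𝓕 : UsualConditions 𝓕 P)
    (hV : MemBMOVar 𝓕 P p V s t) (h0 : eLpNorm (V s) ∞ P < ∞) (hp : 1 ≤ p)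
    (hst : s < t) (hs : ∀ u, s ≤ u) (ht : ∀ u, u ≤ t) {q r : ℝ} (hq : 1 ≤ q) (hr : 1 ≤ r) :
    pqrNorm 𝓕 P p q (ENNReal.ofReal r) (increment fun t ω => Real.exp (V t ω)) s t < ∞ := by
  set K := (bmoVarNorm 𝓕 P p V s t).toNNReal with hKdef
  have hK : bmoVarNorm 𝓕 P p V s t = K := (ENNReal.coe_toNNReal hV.norm_lt_top.ne).symm
  set K₀ := (eLpNorm (V s) ∞ P).toNNReal with hK₀def
  have hK₀ : eLpNorm (V s) ∞ P = K₀ := (ENNReal.coe_toNNReal h0.ne).symm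
  -- The auxiliary exponent `q * r + 1` is any number above `q * r`; the bound below uses it only
  -- for the constants `0` and `1`.
  have hqr : q * r < q * r + 1 := lt_add_one _
  have hqr0 : 0 < q * r + 1 := by nlinarith
  set C := expIncrementConst p (q * r + 1) q r K₀ K₀ K K with hC
  have hzero : ∀ 𝒢, condNorm P (q * r + 1) (ENNReal.ofReal r) 𝒢 (fun _ : Ω => (0 : ℝ)) = 0 := by
    intro 𝒢
    have : (fun ω : Ω => ‖(0 : ℝ)‖ₑ ^ (q * r + 1)) = (0 : Ω → ℝ≥0∞) := by
      ext
      simp [hqr0]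
    simp only [condNorm, this, condLExp_zero, eLpNorm_zero]
    exact ENNReal.zero_rpow_of_pos (by positivity)
  have key : ∀ u v, s ≤ u → u < v → v ≤ t →
      condNorm P q (ENNReal.ofReal r) (𝓕 u) (increment (fun t ω => Real.exp (V t ω)) u v) ≤
        C * (0 + 1 * meanVariation 𝓕 P V u v) := fun u v _ huv _ => by
    -- Taking `V' = V`, `D = 0` and `D₀ = 1` leaves only the term carrying the mean variation, whose
    -- `p`-variation is finite.
    have := condNorm_le_of_exp_bound h𝓕 hV hK.le hV hK.le hK₀.le hK₀.le hp hst hs ht hq hr hqr huv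
      (F := increment (fun t ω => Real.exp (V t ω)) u v) (D := fun _ => 0) (D₀ := fun _ => 1)
      measurable_const measurable_const (fun ω => by
        simpa [increment] using abs_exp_increment_le (V u ω) (V v ω))
    refine this.trans_eq ?_
    rw [hzero, eLpNorm_const _ (by simpa using hqr0) (IsProbabilityMeasure.ne_zero P)]
    simp [hC]
  have := pVariation_le_of_le hp key (w₂ := fun _ _ => 0)
  refine this.trans_lt (ENNReal.mul_lt_top ?_ (ENNReal.add_lt_top.2 ⟨?_, ?_⟩))
  · exact (expIncrementConst_ne_top hq hr hqr _ _ _ _ _).lt_top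
  · have hp0 : 0 < p := by linarith
    simp [pVariation, hp0, ENNReal.zero_rpow_of_pos]
  · simpa using (show pVariation p (meanVariation 𝓕 P V) s t < ∞ from hV.norm_lt_top)

/-- The value `V u - V' u` enters each local estimate but is bounded in `L^q` uniformly in `u` by
`N₀ + N`. It thus comes out of the partition sum, leaving the `p`-variation of the mean variation of
`V'`. -/
lemma pqrNorm_exp_sub_exp_le (h𝓕 : UsualConditions 𝓕 P)
    (hV : MemBMOVar 𝓕 P p V s t) (hK : bmoVarNorm 𝓕 P p V s t ≤ K)
    (hV' : MemBMOVar 𝓕 P p V' s t) (hK' : bmoVarNorm 𝓕 P p V' s t ≤ K')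
    (hK₀ : eLpNorm (V s) ∞ P ≤ K₀) (hK₀' : eLpNorm (V' s) ∞ P ≤ K₀') (hp : 1 ≤ p)
    (hst : s < t) (hs : ∀ u, s ≤ u) (ht : ∀ u, u ≤ t) {q q' r : ℝ} (hq : 1 ≤ q) (hq' : 1 ≤ q')
    (hr : 1 ≤ r) (hqq' : q' * r < q) :
    pqrNorm 𝓕 P p q' (ENNReal.ofReal r)
        (increment fun t ω => Real.exp (V t ω) - Real.exp (V' t ω)) s t ≤
      expIncrementConst p q q' r K₀ K₀' K K' * (1 + K') *
        (eLpNorm (fun ω => V s ω - V' s ω) (ENNReal.ofReal q) P +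
          pqrNorm 𝓕 P p q (ENNReal.ofReal r) (increment fun t ω => V t ω - V' t ω) s t) := by
  set D : ι → Ω → ℝ := fun t ω => V t ω - V' t ω with hD
  have hDm : ∀ u, Measurable (D u) := fun u => (hV.measurable u).sub (hV'.measurable u)
  set C := expIncrementConst p q q' r K₀ K₀' K K' with hC
  set N := pqrNorm 𝓕 P p q (ENNReal.ofReal r) (increment D) s t with hN
  set N₀ := eLpNorm (D s) (ENNReal.ofReal q) P with hN₀
  have key : ∀ u v, s ≤ u → u < v → v ≤ t →
      condNorm P q' (ENNReal.ofReal r) (𝓕 u)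
        (increment (fun t ω => Real.exp (V t ω) - Real.exp (V' t ω)) u v) ≤
        C * (condNorm P q (ENNReal.ofReal r) (𝓕 u) (increment D u v) +
          (N₀ + N) * meanVariation 𝓕 P V' u v) := fun u v hsu huv hvt => by
    refine (condNorm_le_of_exp_bound h𝓕 hV hK hV' hK' hK₀ hK₀' hp hst hs ht hq' hr hqq' huv
      (D := increment D u v) (D₀ := D u) ((hDm v).sub (hDm u))
      ((hV.adapted u).measurable.sub (hV'.adapted u).measurable)
      (fun ω => abs_exp_sub_exp_increment_le _ _ _ _)).trans ?_
    rw [mul_comm (meanVariation 𝓕 P V' u v)]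
    gcongr
    exact eLpNorm_le_add_pqrNorm hDm hp hq hr hsu (huv.le.trans hvt)
  calc _ ≤ C * (N + (N₀ + N) * bmoVarNorm 𝓕 P p V' s t) := pVariation_le_of_le hp key
    _ ≤ C * ((N₀ + N) + (N₀ + N) * K') := by
        gcongr
        exact le_add_self
    _ = _ := by ring

end Increments

end RoughBMO

/-! ### The proposition on `[0,T]` -/

theorem mainTheorem12 (p : ℝ) (hp : 1 ≤ p) :
    (∀ (T : ℝ) (hT : 0 < T) (Ω : Type u) [mΩ : MeasurableSpace Ω] (P : Measure Ω)
        [IsProbabilityMeasure P] (𝓕 : Filtration (Icc (0 : ℝ) T) mΩ),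
        RoughBMO.UsualConditions 𝓕 P →
      ∀ V : Icc (0 : ℝ) T → Ω → ℝ,
        RoughBMO.MemBMOVar 𝓕 P p V (RoughBMO.startTime hT) (RoughBMO.endTime hT) →
        MemLp (V (RoughBMO.startTime hT)) ∞ P →
      ∀ q r : ℝ, 1 ≤ q → 1 ≤ r →
        RoughBMO.MemVpLqr 𝓕 P p q (ENNReal.ofReal r) (fun t ω => Real.exp (V t ω))
          (RoughBMO.startTime hT) (RoughBMO.endTime hT)) ∧
    (∀ q q' r : ℝ, 1 ≤ q → 1 ≤ q' → 1 ≤ r → q' * r < q →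
      ∀ K₀ K₀' K K' : ℝ≥0, ∃ C : ℝ≥0, 0 < C ∧
      ∀ (T : ℝ) (hT : 0 < T) (Ω : Type u) [mΩ : MeasurableSpace Ω] (P : Measure Ω)
        [IsProbabilityMeasure P] (𝓕 : Filtration (Icc (0 : ℝ) T) mΩ),
        RoughBMO.UsualConditions 𝓕 P →
      ∀ V V' : Icc (0 : ℝ) T → Ω → ℝ,
        RoughBMO.MemBMOVar 𝓕 P p V (RoughBMO.startTime hT) (RoughBMO.endTime hT) →
        RoughBMO.MemBMOVar 𝓕 P p V' (RoughBMO.startTime hT) (RoughBMO.endTime hT) →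
        eLpNorm (V (RoughBMO.startTime hT)) ∞ P ≤ K₀ →
        eLpNorm (V' (RoughBMO.startTime hT)) ∞ P ≤ K₀' →
        RoughBMO.bmoVarNorm 𝓕 P p V (RoughBMO.startTime hT) (RoughBMO.endTime hT) ≤ K →
        RoughBMO.bmoVarNorm 𝓕 P p V' (RoughBMO.startTime hT) (RoughBMO.endTime hT) ≤ K' →
        RoughBMO.pqrNorm 𝓕 P p q' (ENNReal.ofReal r)
            (RoughBMO.increment fun t ω => Real.exp (V t ω) - Real.exp (V' t ω))
            (RoughBMO.startTime hT) (RoughBMO.endTime hT) ≤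
          C * (eLpNorm (fun ω => V (RoughBMO.startTime hT) ω - V' (RoughBMO.startTime hT) ω)
                (ENNReal.ofReal q) P +
              RoughBMO.pqrNorm 𝓕 P p q (ENNReal.ofReal r)
                (RoughBMO.increment fun t ω => V t ω - V' t ω)
                (RoughBMO.startTime hT) (RoughBMO.endTime hT))) := by
  have hlt : ∀ {T : ℝ} (hT : 0 < T), RoughBMO.startTime hT < RoughBMO.endTime hT :=
    fun hT => hT
  have hs : ∀ {T : ℝ} (hT : 0 < T) (u : Icc (0 : ℝ) T), RoughBMO.startTime hT ≤ u :=
    fun hT u => u.2.1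
  have ht : ∀ {T : ℝ} (hT : 0 < T) (u : Icc (0 : ℝ) T), u ≤ RoughBMO.endTime hT :=
    fun hT u => u.2.2
  refine ⟨?_, ?_⟩
  · intro T hT Ω mΩ P _ 𝓕 h𝓕 V hV hV0 q r hq hr
    refine ⟨fun u => (Real.measurable_exp.comp (hV.measurable u)).stronglyMeasurable, ?_, ?_,
      hV.pqrNorm_exp_lt_top h𝓕 hV0.2 hp (hlt hT) (hs hT) (ht hT) hq hr⟩
    · filter_upwards [hV.cadlag] with ω hω u
      obtain ⟨hright, l, hl⟩ := hω u
      exact ⟨Real.continuous_exp.continuousAt.comp_continuousWithinAt hright, Real.exp l,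
        (Real.continuous_exp.tendsto l).comp hl⟩
    · have hm : Measurable fun ω => Real.exp (V (RoughBMO.startTime hT) ω) :=
        Real.measurable_exp.comp (hV.measurable _)
      refine MemLp.of_bound hm.aestronglyMeasurable
        (Real.exp (eLpNorm (V (RoughBMO.startTime hT)) ∞ P).toReal) ?_
      filter_upwards [ae_le_eLpNormEssSup (f := V (RoughBMO.startTime hT)) (μ := P)] with ω hω
      rw [Real.norm_eq_abs, Real.abs_exp]
      refine Real.exp_le_exp.2 ((le_abs_self _).trans ?_)
      have := ENNReal.toReal_mono hV0.2.ne hω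
      simpa using this
  · intro q q' r hq hq' hr hqq' K₀ K₀' K K'
    set C := RoughBMO.expIncrementConst p q q' r K₀ K₀' K K' * (1 + (K' : ℝ≥0∞)) with hC
    have hCtop : C ≠ ∞ := ENNReal.mul_ne_top
      (RoughBMO.expIncrementConst_ne_top hq' hr hqq' _ _ _ _ _) (by simp)
    -- Adding `1` only secures strict positivity.
    refine ⟨C.toNNReal + 1, by positivity, ?_⟩
    intro T hT Ω mΩ P _ 𝓕 h𝓕 V V' hV hV' hK₀ hK₀' hK hK'
    refine (RoughBMO.pqrNorm_exp_sub_exp_le h𝓕 hV hK hV' hK' hK₀ hK₀' hp (hlt hT) (hs hT) (ht hT)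
      hq hq' hr hqq').trans ?_
    gcongr
    rw [ENNReal.coe_add, ENNReal.coe_toNNReal hCtop]
    exact le_self_add
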